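/- Let $X\subset\mathbb{R}^D$ be a smooth compact $d$-dimensional embedded submanifold (possibly with boundary or corners), with normalised Lebesgue (Riemannian volume) measure $m$. Let $\xi:\mathbb{R}\times\Xi\to\Xi$ be a flow on a space $\Xi$ of generalised times. Let $F:\Xi\times X\to\mathbb{R}^D$ be a vector field tangent to $X$ such that, for every $z\in\Xi$, $F(\xi(t,z),x)$ is continuous in $(t,x)$, is $C^1$ in $x$, and has $x$-derivative continuous in $(t,x)$. Let $\phi:\mathbb{R}\times\Xi\times X\to X$ be the flow of $\dot x(t)=F(\xi(t,z),x(t))$, that is, $\phi(0,z,x)=x$ and $\frac{d}{dt}\phi(t,z,x)=F(\xi(t,z),\phi(t,z,x))$ for all $t\in\mathbb{R}$. For $t\ge 0$ let $$\mathcal{P}_z^{(t)}f(x)=f(\phi(-t,\xi(t,z),x))\,|\det D\phi(-t,\xi(t,z),x)|$$ be the Perron–Frobenius operators. Let $\{B_1,\dots,B_n\}$ be a partition of $X$ into connected measurable sets of positive measure, and put $\pi_nf=\sum_{i}\frac{1}{m(B_i)}\int_{B_i}f\,dm\;\chi_{B_i}$. Let $P^{(t)}(z)$ be the matrix of $\pi_n\mathcal{P}_z^{(t)}$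 on $\mathrm{span}\{\chi_{B_1},\dots,\chi_{B_n}\}$ in the basis $(\chi_{B_i})$. For real $M>0$ let $\Psi^{(M)}(z)=\left(P^{(M)}(z)^\top P^{(M)}(z)\right)^{1/2M}$, let $L_1>L_2>\dots>L_\ell$ be its distinct eigenvalues, and let $U^{(M)}_j(z)\subset\mathbb{R}^n$ be the eigenspace of $L_j$. Fix real numbers $M>0$, $N\ge 0$ and $z\in\Xi$. Assume that $U^{(M)}_2(\xi(-N,z))$ is one-dimensional, and that $\dim U_1^{(M)}(\xi(-N+\delta,z))=\dim U_1^{(M)}(\xi(-N,z))$ for all sufficiently small $|\delta|$ (which holds automatically if $\dim U_1^{(M)}(\xi(-N,z))=1$). Then $U^{(M)}_2(\xi(-N+\delta,z))$ is one-dimensional for all sufficiently small $|\delta|$. For such $\delta$ let $$\hat f_{n,\xi(\delta,z),M,N}=\pi_n\mathcal{P}^{(N)}_{\xi(-N+\delta,z)}\sum_{i=1}^n u_i\chi_{B_i},\qquad u\in U_2^{(M)}(\xi(-N+\delta,z)),\quad \Big\|\sum_{i=1}^n u_i\chi_{B_i}\Big\|_{L^1(m)}=1,$$ be the approximate Oseledets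 function at time $\xi(\delta,z)$; it is determined up to sign. For any choice of these functions there are signs $s(\delta)\in\{1,-1\}$ such that $$\big\|s(\delta)\,\hat f_{n,\xi(\delta,z),M,N}-\hat f_{n,z,M,N}\big\|_{L^1(m)}\to 0\qquad\text{as }\delta\to 0.$$ -/

import Mathlib

open Set Filter Topology MeasureTheory
open scoped ContDiff Manifold ENNReal MeasureTheory

/-- A flow `ξ` (autonomous, real time) on the space `Ξ` of generalised times. -/
structure IsDrivingFlow {Ξ : Type*} (ξ : ℝ → Ξ → Ξ) : Prop where
  zero : ∀ z, ξ 0 z = z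
  add : ∀ s t z, ξ (s + t) z = ξ s (ξ t z)

section Manifold

variable {d D : ℕ} {H : Type*} [TopologicalSpace H]
  (I : ModelWithCorners ℝ (EuclideanSpace ℝ (Fin d)) H)
  {X : Set (EuclideanSpace ℝ (Fin D))} [ChartedSpace H X]

/-- The derivative `T_x X → ℝ^D` at `x` of a map `g : X → ℝ^D`. -/
noncomputable def ambientDeriv (g : X → EuclideanSpace ℝ (Fin D)) (x : X) :
    EuclideanSpace ℝ (Fin d) →L[ℝ] EuclideanSpace ℝ (Fin D) :=
  mfderiv I 𝓘(ℝ, EuclideanSpace ℝ (Fin D)) g x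

variable (X) in
/-- The inclusion of `X` into `ℝ^D` is a smooth immersion (it is a topological embedding because
`X` carries the subspace topology), so that `X` is an embedded submanifold of `ℝ^D`. -/
structure IsSubmanifold : Prop where
  contMDiff : ContMDiff I 𝓘(ℝ, EuclideanSpace ℝ (Fin D)) ∞
    (Subtype.val : X → EuclideanSpace ℝ (Fin D))
  immersion : ∀ x : X, Function.Injective (ambientDeriv I Subtype.val x)

/-- Regularity of the time-dependent vector field `F`, regarded as a map into `ℝ^D`: along every
orbit of the driving flow it is continuous in `(t, x)`, it is `C¹` in `x`, and its derivative with
respect to `x` is continuous in `(t, x)`, that is, as a map on `ℝ × TX`. -/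
structure IsRegularField [IsManifold I 1 X] {Ξ : Type*} (ξ : ℝ → Ξ → Ξ)
    (F : Ξ → X → EuclideanSpace ℝ (Fin D)) : Prop where
  continuous : ∀ z, Continuous fun p : ℝ × X => F (ξ p.1 z) p.2
  contMDiff : ∀ z, ContMDiff I 𝓘(ℝ, EuclideanSpace ℝ (Fin D)) 1 (F z)
  continuous_deriv : ∀ z, Continuous fun p : ℝ × TangentBundle I X =>
    ambientDeriv I (F (ξ p.1 z)) p.2.proj p.2.snd

end Manifold

/-- `φ` is the flow on `X` of the nonautonomous equation `x'(t) = F (ξ (t, z), x(t))`. As `φ` takes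
values in `X`, the field `F` is automatically tangent to `X`. -/
structure IsFlowOf {D : ℕ} {X : Set (EuclideanSpace ℝ (Fin D))} {Ξ : Type*} (ξ : ℝ → Ξ → Ξ)
    (F : Ξ → X → EuclideanSpace ℝ (Fin D)) (φ : ℝ → Ξ → X → X) : Prop where
  zero : ∀ z x, φ 0 z x = x
  hasDerivAt : ∀ t z x, HasDerivAt (fun s => (φ s z x : EuclideanSpace ℝ (Fin D)))
    (F (ξ t z) (φ t z x)) t

noncomputable section

/-- Normalised Lebesgue measure (Riemannian volume) on a compact `d`-dimensional submanifold `X` of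
`ℝ^D`: the `d`-dimensional Hausdorff measure divided by the total mass. -/
def normVolume (d : ℕ) {D : ℕ} (X : Set (EuclideanSpace ℝ (Fin D))) : Measure X :=
  (Measure.hausdorffMeasure (X := X) (d : ℝ) univ)⁻¹ • Measure.hausdorffMeasure (X := X) (d : ℝ)

section Jacobian

variable {d D : ℕ} {H : Type*} [TopologicalSpace H]
  (I : ModelWithCorners ℝ (EuclideanSpace ℝ (Fin d)) H)
  {X : Set (EuclideanSpace ℝ (Fin D))} [ChartedSpace H X]

/-- The Gram determinant of the images of a fixed basis of the tangent space `T_x X` under the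
derivative at `x` of a map `g : X → ℝ^D`, that is, the squared volume of the parallelepiped which
these images span. -/
def gramDet (g : X → EuclideanSpace ℝ (Fin D)) (x : X) : ℝ :=
  Matrix.det (Matrix.of fun i j : Fin d =>
    inner ℝ (ambientDeriv I g x (EuclideanSpace.single i 1))
      (ambientDeriv I g x (EuclideanSpace.single j 1)))

/-- `|det Dψ(x)|` for `ψ : X → X`, where the tangent spaces of `X` carry the inner products of
`ℝ^D`: the factor by which `Dψ(x) : T_x X → T_ψ(x) X` changes `d`-dimensional volumes. -/
def absDet (ψ : X → X) (x : X) : ℝ :=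
  √(gramDet I (fun y => (ψ y : EuclideanSpace ℝ (Fin D))) x / gramDet I Subtype.val x)

/-- The Perron–Frobenius operators
`P_z^(t) f (x) = f (φ (-t, ξ (t, z), x)) * |det Dφ (-t, ξ (t, z), x)|`, for `t ≥ 0`. -/
def perronFrobenius {Ξ : Type*} (ξ : ℝ → Ξ → Ξ) (φ : ℝ → Ξ → X → X) (z : Ξ) (t : ℝ)
    (f : X → ℝ) (x : X) : ℝ :=
  f (φ (-t) (ξ t z) x) * absDet I (φ (-t) (ξ t z)) x

end Jacobian

/-- A partition of the measure space `(X, m)` into `n` connected (measurable) sets of positive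
measure. -/
structure IsPositivePartition {X : Type*} [TopologicalSpace X] [MeasurableSpace X] (m : Measure X)
    {n : ℕ} (B : Fin n → Set X) : Prop where
  disjoint : Pairwise fun i j => Disjoint (B i) (B j)
  iUnion : ⋃ i, B i = univ
  connected : ∀ i, IsConnected (B i)
  measurable : ∀ i, MeasurableSet (B i)
  pos : ∀ i, 0 < m (B i)

/-- The function `∑ i, u i • χ_{B i}`. -/
def stepFun {X : Type*} {n : ℕ} (B : Fin n → Set X) (u : Fin n → ℝ) (x : X) : ℝ :=
  ∑ i, (B i).indicator (fun _ => u i) x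

/-- The projection `π_n f = ∑ i, (∫_{B i} f dm / m (B i)) χ_{B i}`. -/
def galerkin {X : Type*} [MeasurableSpace X] (m : Measure X) {n : ℕ} (B : Fin n → Set X)
    (f : X → ℝ) : X → ℝ :=
  stepFun B fun i => (∫ x in B i, f x ∂m) / m.real (B i)

/-- The eigenspace of the `j`-th largest of the distinct eigenvalues `L_1 > L_2 > ⋯ > L_ℓ` of a
real matrix (`1 ≤ j ≤ ℓ`; it is the zero space if `j > ℓ`). -/
def orderedEigenspace {n : ℕ} (A : Matrix (Fin n) (Fin n) ℝ) (j : ℕ) :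
    Submodule ℝ (Fin n → ℝ) :=
  ⨆ μ ∈ {μ : ℝ | Module.End.HasEigenvalue (Matrix.toLin' A) μ ∧
      {ν : ℝ | Module.End.HasEigenvalue (Matrix.toLin' A) ν ∧ μ ≤ ν}.ncard = j},
    Module.End.eigenspace (Matrix.toLin' A) μ

section Algorithm

variable {d D : ℕ} {H : Type*} [TopologicalSpace H]
  (I : ModelWithCorners ℝ (EuclideanSpace ℝ (Fin d)) H)
  {X : Set (EuclideanSpace ℝ (Fin D))} [ChartedSpace H X]
  {Ξ : Type*} (ξ : ℝ → Ξ → Ξ) (φ : ℝ → Ξ → X → X) {n : ℕ} (B : Fin n → Set X)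

/-- The matrix `P^(t)(z)` of `π_n P_z^(t)` on the span of the `χ_{B i}`: the `i`-th coefficient of
`π_n P_z^(t) χ_{B j}`, so that `π_n P_z^(t) (∑ u_j χ_{B j}) = ∑ (P^(t)(z) u)_i χ_{B i}`. -/
def ulamMatrix (z : Ξ) (t : ℝ) : Matrix (Fin n) (Fin n) ℝ :=
  Matrix.of fun i j =>
    (∫ x in B i, perronFrobenius I ξ φ z t ((B j).indicator fun _ => 1) x ∂(normVolume d X)) /
      (normVolume d X).real (B i)

/-- The matrix `Ψ^(M)(z) = (P^(M)(z)ᵀ P^(M)(z))^(1/2M)`; the power of the positive semidefinite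
matrix is taken by the functional calculus of symmetric matrices. -/
def psiMatrix (M : ℝ) (z : Ξ) : Matrix (Fin n) (Fin n) ℝ :=
  cfc (fun a : ℝ => a ^ (1 / (2 * M)))
    ((ulamMatrix I ξ φ B z M).transpose * ulamMatrix I ξ φ B z M)

/-- The eigenspaces `U_j^(M)(z)` of `Ψ^(M)(z)`, ordered by decreasing eigenvalue. -/
def singularSpace (M : ℝ) (j : ℕ) (z : Ξ) : Submodule ℝ (Fin n → ℝ) :=
  orderedEigenspace (psiMatrix I ξ φ B M z) j

/-- `g` is the approximate Oseledets function at time `z` (unique up to sign if `U_2^(M)` is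
one-dimensional at time `ξ (-N, z)`): `g = π_n P^(N)_{ξ(-N,z)} f`, where `f = ∑ u_i χ_{B i}` with
`u` in `U_2^(M)(ξ (-N, z))` is scaled to have `L¹` norm one. -/
def IsApproxOseledets (M N : ℝ) (z : Ξ) (g : X → ℝ) : Prop :=
  ∃ u ∈ singularSpace I ξ φ B M 2 (ξ (-N) z),
    eLpNorm (stepFun B u) 1 (normVolume d X) = 1 ∧
    g = galerkin (normVolume d X) B (perronFrobenius I ξ φ (ξ (-N) z) N (stepFun B u))

end Algorithm

end

/-! The proof shows that the Ulam matrices `P^(t)(ξ(b,z))` depend continuously on `b`, and then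
perturbs a simple eigenvalue of a symmetric matrix.

Continuity of the matrices. An entry is, up to a constant factor, the integral over `B i` of `χ_{B
j} ∘ ψ_b * |det Dψ_b|`, where `ψ_b` is a flow map. The indicator is discontinuous, so it is
approximated in `L¹` by a bounded continuous function. The error is uniform in `b`, because `ψ_b`
has a uniformly Lipschitz inverse and therefore pulls small sets back to small sets
(`continuousAt_setIntegral_comp_mul`). There remains the joint continuity of `ψ_b(x)` and of `|det
Dψ_b(x)|`. As `X` may have boundary or corners, the flow is studied inside `ℝ^D`: the field gets a
Whitney derivative, namely an endomorphism of `ℝ^D` that approximates its increments uniformly on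
`X` (`exists_whitney`). The variational equation is then a linear equation in a Banach algebra, and
Gronwall's inequality shows that its solution is a Whitney derivative of the flow
(`exists_whitney_deriv`). Its restriction to the tangent spaces gives the Jacobian as a quotient of
Gram determinants (`continuousOn_absDet`).

Perturbation. The root in `Ψ^(M)` changes no ordered eigenspace, so `Pᵀ P` can replace it. Along an
ultrafilter the orthonormal eigenbases converge by compactness. Strict inequalities between limit
eigenvalues persist nearby, and the constant dimension of `U₁` prevents the top eigenvalue from
splitting, which could create a new second eigenvalue. Hence the second eigenvalue stays simple, and
limits of vectors in `U₂` lie in the limit line (`orderedEigenspace_two_perturbation`). Normalised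
vectors in these lines, with signs chosen by an inner product, converge (`exists_sign_tendsto`), and
so do their images under `P^(N)`. -/

open scoped Matrix in
/-- The vectors `v i` form an orthonormal basis of eigenvectors of `A`, with eigenvalues `l i`. -/
structure IsEigenbasis {n : ℕ} (A : Matrix (Fin n) (Fin n) ℝ) (v : Fin n → Fin n → ℝ)
    (l : Fin n → ℝ) : Prop where
  orthonormal : ∀ i j, v i ⬝ᵥ v j = if i = j then 1 else 0
  eigen : ∀ i, A *ᵥ v i = l i • v i

/-! ### Ordered eigenspaces of symmetric matrices and their perturbation -/

section Spectral

open scoped Matrix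

variable {n : ℕ} {A A' : Matrix (Fin n) (Fin n) ℝ} {v : Fin n → Fin n → ℝ} {l : Fin n → ℝ}

theorem Matrix.IsHermitian.isEigenbasis (hA : A.IsHermitian) :
    IsEigenbasis A (fun i => ⇑(hA.eigenvectorBasis i)) hA.eigenvalues where
  orthonormal i j := by
    have := orthonormal_iff_ite.1 hA.eigenvectorBasis.orthonormal j i
    simp only [EuclideanSpace.inner_eq_star_dotProduct, star_trivial, eq_comm (a := j)] at this
    exact this
  eigen i := hA.mulVec_eigenvectorBasis i

/-- The eigenvectors are those of `A` itself, so that the eigenspaces of `A` and of `f(A)` can be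
compared index by index. -/
theorem Matrix.IsHermitian.isEigenbasis_cfc (hA : A.IsHermitian) (f : ℝ → ℝ) :
    IsEigenbasis (cfc f A) (fun i => ⇑(hA.eigenvectorBasis i)) (f ∘ hA.eigenvalues) where
  orthonormal := hA.isEigenbasis.orthonormal
  eigen i := by
    rw [hA.cfc_eq, Matrix.IsHermitian.cfc, Unitary.conjStarAlgAut_apply, ← Matrix.mulVec_mulVec,
      ← Matrix.mulVec_mulVec]
    have h := hA.star_eigenvectorUnitary_mulVec i
    rw [h, Matrix.diagonal_mulVec_single, mul_one]
    have : (Pi.single i ((RCLike.ofReal ∘ f ∘ hA.eigenvalues) i) : Fin n → ℝ) =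
        (f ∘ hA.eigenvalues) i • Pi.single i 1 := by
      rw [← Pi.single_smul]; simp
    rw [this, Matrix.mulVec_smul, hA.eigenvectorUnitary_mulVec]

namespace IsEigenbasis

theorem sum_smul (h : IsEigenbasis A v l) (x : Fin n → ℝ) : ∑ i, (v i ⬝ᵥ x) • v i = x := by
  have h1 : Matrix.of v * (Matrix.of v)ᵀ = 1 := by
    ext i j
    rw [Matrix.one_apply, ← h.orthonormal i j]
    rfl
  -- For a square matrix, orthonormal rows also give the completeness relation.
  have h2 := mul_eq_one_comm.1 h1
  have h3 : (Matrix.of v)ᵀ *ᵥ (Matrix.of v *ᵥ x) = x := by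
    rw [Matrix.mulVec_mulVec, h2, Matrix.one_mulVec]
  conv_rhs => rw [← h3]
  ext k
  simp only [Finset.sum_apply, Pi.smul_apply, smul_eq_mul, Matrix.mulVec, dotProduct,
    Matrix.transpose_apply, Matrix.of_apply]
  exact Finset.sum_congr rfl fun i _ => mul_comm _ _

theorem dotProduct_sum (h : IsEigenbasis A v l) (c : Fin n → ℝ) (i : Fin n) :
    v i ⬝ᵥ (∑ j, c j • v j) = c i := by
  simp [_root_.dotProduct_sum, dotProduct_smul, h.orthonormal]

theorem dotProduct_mulVec (h : IsEigenbasis A v l) (x : Fin n → ℝ) (i : Fin n) :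
    v i ⬝ᵥ (A *ᵥ x) = l i * (v i ⬝ᵥ x) := by
  conv_lhs => rw [← h.sum_smul x, Matrix.mulVec_sum]
  simp only [Matrix.mulVec_smul, h.eigen, smul_smul]
  rw [h.dotProduct_sum, mul_comm]

theorem ext_dotProduct (h : IsEigenbasis A v l) {x y : Fin n → ℝ}
    (hxy : ∀ i, v i ⬝ᵥ x = v i ⬝ᵥ y) : x = y := by
  rw [← h.sum_smul x, ← h.sum_smul y]
  simp only [hxy]

theorem mem_eigenspace (h : IsEigenbasis A v l) {μ : ℝ} {x : Fin n → ℝ} :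
    x ∈ Module.End.eigenspace (Matrix.toLin' A) μ ↔ ∀ i, l i ≠ μ → v i ⬝ᵥ x = 0 := by
  rw [Module.End.mem_eigenspace_iff, Matrix.toLin'_apply]
  refine ⟨fun hx i hi => ?_, fun hx => h.ext_dotProduct fun i => ?_⟩
  · have := h.dotProduct_mulVec x i
    rw [hx, dotProduct_smul, smul_eq_mul] at this
    have h0 : (l i - μ) * (v i ⬝ᵥ x) = 0 := by linarith
    exact (mul_eq_zero.1 h0).resolve_left (sub_ne_zero.2 hi)
  · rw [h.dotProduct_mulVec, dotProduct_smul, smul_eq_mul]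
    by_cases hi : l i = μ
    · rw [hi]
    · rw [hx i hi, mul_zero, mul_zero]

theorem ne_zero (h : IsEigenbasis A v l) (i : Fin n) : v i ≠ 0 := fun h0 => by
  have := h.orthonormal i i
  simp [h0] at this

theorem mem_eigenspace_self (h : IsEigenbasis A v l) (i : Fin n) :
    v i ∈ Module.End.eigenspace (Matrix.toLin' A) (l i) :=
  h.mem_eigenspace.2 fun j hj => by
    rw [h.orthonormal, if_neg]
    rintro rfl
    exact hj rfl

theorem hasEigenvalue_iff (h : IsEigenbasis A v l) {μ : ℝ} :
    Module.End.HasEigenvalue (Matrix.toLin' A) μ ↔ μ ∈ range l := by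
  constructor
  · intro hμ
    obtain ⟨x, hx, hx0⟩ := hμ.exists_hasEigenvector
    by_contra hr
    refine hx0 (h.ext_dotProduct fun i => ?_)
    rw [h.mem_eigenspace.1 hx i fun hi => hr ⟨i, hi⟩, dotProduct_zero]
  · rintro ⟨i, rfl⟩
    exact Module.End.hasEigenvalue_of_hasEigenvector ⟨h.mem_eigenspace_self i, h.ne_zero i⟩

theorem linearIndependent (h : IsEigenbasis A v l) : LinearIndependent ℝ v := by
  rw [Fintype.linearIndependent_iff]
  intro c hc i
  rw [← h.dotProduct_sum c i, hc, dotProduct_zero]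

theorem finrank_eigenspace (h : IsEigenbasis A v l) (μ : ℝ) :
    Module.finrank ℝ (Module.End.eigenspace (Matrix.toLin' A) μ) =
      (Finset.univ.filter fun i => l i = μ).card := by
  have hs : Module.End.eigenspace (Matrix.toLin' A) μ =
      Submodule.span ℝ (range fun i : {i // l i = μ} => v i) := by
    apply le_antisymm
    · intro x hx
      rw [← h.sum_smul x]
      refine Submodule.sum_mem _ fun i _ => ?_
      by_cases hi : l i = μ
      · exact Submodule.smul_mem _ _ (Submodule.subset_span ⟨⟨i, hi⟩, rfl⟩)
      · rw [h.mem_eigenspace.1 hx i hi, zero_smul]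
        exact Submodule.zero_mem _
    · rw [Submodule.span_le]
      rintro _ ⟨⟨i, rfl⟩, rfl⟩
      exact h.mem_eigenspace_self i
  rw [hs, ← Fintype.card_subtype]
  exact finrank_span_eq_card (h.linearIndependent.comp _ Subtype.val_injective)

theorem orderedEigenspace_eq_iSup (h : IsEigenbasis A v l) (j : ℕ) :
    orderedEigenspace A j = ⨆ i ∈ {i | {ν ∈ range l | l i ≤ ν}.ncard = j},
      Module.End.eigenspace (Matrix.toLin' A) (l i) := by
  have e : ∀ μ, {ν : ℝ | Module.End.HasEigenvalue (Matrix.toLin' A) ν ∧ μ ≤ ν} =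
      {ν ∈ range l | μ ≤ ν} := fun μ => by
    ext ν
    simp only [mem_ofPred_eq, h.hasEigenvalue_iff]
  apply le_antisymm
  · refine iSup₂_le fun μ hμ => ?_
    obtain ⟨i, rfl⟩ := h.hasEigenvalue_iff.1 hμ.1
    exact le_iSup₂_of_le i (by rw [← hμ.2, e]; rfl) le_rfl
  · refine iSup₂_le fun i hi => ?_
    exact le_iSup₂_of_le (l i) ⟨h.hasEigenvalue_iff.2 ⟨i, rfl⟩, by rw [e]; exact hi⟩ le_rfl

/-- The position of an eigenvalue in the ordering is the number of distinct eigenvalues not below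
it; being strictly antitone, it determines the eigenvalue. -/
theorem ncard_lt_ncard {i j : Fin n} (hij : l i < l j) :
    {ν ∈ range l | l j ≤ ν}.ncard < {ν ∈ range l | l i ≤ ν}.ncard := by
  refine Set.ncard_lt_ncard ⟨fun ν hν => ⟨hν.1, hij.le.trans hν.2⟩, fun hsub => ?_⟩
    ((finite_range l).subset fun _ h => h.1)
  exact absurd (hsub ⟨⟨i, rfl⟩, le_rfl⟩).2 (not_le.2 hij)

theorem orderedEigenspace_eq (h : IsEigenbasis A v l) {i : Fin n} {j : ℕ}
    (hi : {ν ∈ range l | l i ≤ ν}.ncard = j) :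
    orderedEigenspace A j = Module.End.eigenspace (Matrix.toLin' A) (l i) := by
  rw [h.orderedEigenspace_eq_iSup]
  refine le_antisymm (iSup₂_le fun k hk => ?_) (le_iSup₂_of_le i hi le_rfl)
  have hk : {ν ∈ range l | l k ≤ ν}.ncard = j := hk
  have : l k = l i := by
    rcases lt_trichotomy (l k) (l i) with hlt | heq | hlt
    · have := ncard_lt_ncard hlt; omega
    · exact heq
    · have := ncard_lt_ncard hlt; omega
  rw [this]

/-- A strictly monotone function of a matrix has the same ordered eigenspaces. -/
theorem orderedEigenspace_comp {f : ℝ → ℝ} (h : IsEigenbasis A v l)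
    (h' : IsEigenbasis A' v (f ∘ l)) (hf : StrictMonoOn f (range l)) (j : ℕ) :
    orderedEigenspace A' j = orderedEigenspace A j := by
  rw [h.orderedEigenspace_eq_iSup, h'.orderedEigenspace_eq_iSup]
  have e1 : ∀ i, {ν ∈ range (f ∘ l) | (f ∘ l) i ≤ ν}.ncard = {ν ∈ range l | l i ≤ ν}.ncard := by
    intro i
    have : {ν ∈ range (f ∘ l) | (f ∘ l) i ≤ ν} = f '' {ν ∈ range l | l i ≤ ν} := by
      ext ν
      constructor
      · rintro ⟨⟨k, rfl⟩, hk⟩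
        exact ⟨l k, ⟨⟨k, rfl⟩, (hf.le_iff_le ⟨i, rfl⟩ ⟨k, rfl⟩).1 hk⟩, rfl⟩
      · rintro ⟨_, ⟨⟨k, rfl⟩, hk⟩, rfl⟩
        exact ⟨⟨k, rfl⟩, (hf.le_iff_le ⟨i, rfl⟩ ⟨k, rfl⟩).2 hk⟩
    rw [this]
    exact (hf.injOn.mono fun _ h => h.1).ncard_image
  have e2 : ∀ i, Module.End.eigenspace (Matrix.toLin' A') ((f ∘ l) i) =
      Module.End.eigenspace (Matrix.toLin' A) (l i) := by
    intro i
    ext x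
    rw [h.mem_eigenspace, h'.mem_eigenspace]
    refine forall_congr' fun k => imp_congr_left (not_congr ?_)
    exact hf.injOn.eq_iff ⟨k, rfl⟩ ⟨i, rfl⟩
  simp only [e1, e2]

end IsEigenbasis

/-- The indices `m` and `p` belong to the largest and to the second largest value of `l`, and the
latter is attained only at `p`. -/
structure IsSimpleSecond {n : ℕ} (l : Fin n → ℝ) (m p : Fin n) : Prop where
  le_max : ∀ i, l i ≤ l m
  lt_max : l p < l m
  lt_second : ∀ j, l j ≠ l m → j ≠ p → l j < l p

namespace IsEigenbasis

theorem orderedEigenspace_one (h : IsEigenbasis A v l) {m : Fin n} (hm : ∀ i, l i ≤ l m) :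
    orderedEigenspace A 1 = Module.End.eigenspace (Matrix.toLin' A) (l m) := by
  refine h.orderedEigenspace_eq (ncard_eq_one.2 ⟨l m, ?_⟩)
  ext ν
  constructor
  · rintro ⟨⟨i, rfl⟩, hi⟩
    exact le_antisymm (hm i) hi
  · rintro rfl
    exact ⟨⟨m, rfl⟩, le_rfl⟩

theorem orderedEigenspace_two (h : IsEigenbasis A v l) {m p : Fin n} (hl : IsSimpleSecond l m p) :
    orderedEigenspace A 2 = Module.End.eigenspace (Matrix.toLin' A) (l p) ∧
      Module.finrank ℝ (orderedEigenspace A 2) = 1 := by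
  have e : orderedEigenspace A 2 = Module.End.eigenspace (Matrix.toLin' A) (l p) := by
    refine h.orderedEigenspace_eq (ncard_eq_two.2 ⟨l m, l p, hl.lt_max.ne', ?_⟩)
    ext ν
    constructor
    · rintro ⟨⟨i, rfl⟩, hi⟩
      by_cases him : l i = l m
      · exact Or.inl him
      · by_cases hip : i = p
        · rw [hip]; exact Or.inr rfl
        · exact absurd (hl.lt_second i him hip) (not_lt.2 hi)
    · rintro (rfl | rfl)
      · exact ⟨⟨m, rfl⟩, hl.lt_max.le⟩
      · exact ⟨⟨p, rfl⟩, le_rfl⟩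
  refine ⟨e, ?_⟩
  rw [e, h.finrank_eigenspace, Finset.card_eq_one]
  refine ⟨p, ?_⟩
  ext i
  simp only [Finset.mem_filter, Finset.mem_univ, true_and, Finset.mem_singleton]
  refine ⟨fun hi => ?_, fun hi => by rw [hi]⟩
  by_contra hip
  exact (hl.lt_second i (hi ▸ hl.lt_max.ne) hip).ne hi

theorem exists_isSimpleSecond (h : IsEigenbasis A v l)
    (h2 : Module.finrank ℝ (orderedEigenspace A 2) = 1) : ∃ m p, IsSimpleSecond l m p := by
  have hp : ∃ p, {ν ∈ range l | l p ≤ ν}.ncard = 2 := by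
    by_contra! hne
    rw [h.orderedEigenspace_eq_iSup] at h2
    have : (⨆ i ∈ {i | {ν ∈ range l | l i ≤ ν}.ncard = 2},
        Module.End.eigenspace (Matrix.toLin' A) (l i)) = ⊥ :=
      iSup₂_eq_bot.2 fun i hi => absurd hi (hne i)
    rw [this, finrank_bot] at h2
    exact zero_ne_one h2
  obtain ⟨p, hp⟩ := hp
  have : Nonempty (Fin n) := ⟨p⟩
  obtain ⟨m, hm⟩ := Finite.exists_max l
  refine ⟨m, p, hm, lt_of_le_of_ne (hm p) fun hpm => ?_, fun j hjm hjp => ?_⟩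
  · have : {ν ∈ range l | l p ≤ ν}.ncard = 1 := by
      refine ncard_eq_one.2 ⟨l m, ?_⟩
      ext ν
      constructor
      · rintro ⟨⟨i, rfl⟩, hi⟩
        exact le_antisymm (hm i) (hpm ▸ hi)
      · rintro rfl
        exact ⟨⟨m, rfl⟩, hpm.le⟩
    omega
  · rw [h.orderedEigenspace_eq hp, h.finrank_eigenspace, Finset.card_eq_one] at h2
    obtain ⟨q, hq⟩ := h2
    have hpq : p ∈ ({q} : Finset (Fin n)) := hq ▸ by simp
    by_contra hlt
    rcases (not_lt.1 hlt).eq_or_lt with heq | hlt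
    -- A repeated second value contradicts simplicity; a value strictly between `l p` and `l m`
    -- would put `l p` in third place or lower.
    · have hjq : j ∈ ({q} : Finset (Fin n)) := hq ▸ by simp [heq]
      simp only [Finset.mem_singleton] at hpq hjq
      exact hjp (hjq.trans hpq.symm)
    · have h1 := ncard_lt_ncard hlt
      have h3 := ncard_lt_ncard (lt_of_le_of_ne (hm j) hjm)
      have h4 : 0 < {ν ∈ range l | l m ≤ ν}.ncard :=
        (ncard_pos ((finite_range l).subset fun _ h => h.1)).2 ⟨l m, ⟨m, rfl⟩, le_rfl⟩
      omega

/-- Along an ultrafilter, the eigenbases of a convergent family of matrices converge. -/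
theorem exists_tendsto {α : Type*} {A : α → Matrix (Fin n) (Fin n) ℝ}
    {A₀ : Matrix (Fin n) (Fin n) ℝ} {v : α → Fin n → Fin n → ℝ} {l : α → Fin n → ℝ}
    (h : ∀ a, IsEigenbasis (A a) (v a) (l a)) (U : Ultrafilter α) (hA : Tendsto A U (𝓝 A₀)) :
    ∃ v₀ l₀, IsEigenbasis A₀ v₀ l₀ ∧ Tendsto l U (𝓝 l₀) := by
  have hv : ∀ a, v a ∈ Set.pi univ fun _ : Fin n => Set.pi univ fun _ : Fin n =>
      Icc (-1 : ℝ) 1 := by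
    intro a i _ k _
    have h1 := (h a).orthonormal i i
    rw [if_pos rfl] at h1
    have h2 : v a i k * v a i k ≤ 1 := by
      rw [← h1]
      exact Finset.single_le_sum (f := fun k => v a i k * v a i k)
        (fun k _ => mul_self_nonneg _) (Finset.mem_univ k)
    exact abs_le.1 (abs_le_one_iff_mul_self_le_one.2 h2)
  obtain ⟨v₀, -, hv₀⟩ := (isCompact_univ_pi fun _ : Fin n => isCompact_univ_pi fun _ : Fin n =>
    isCompact_Icc (a := (-1 : ℝ)) (b := 1)).ultrafilter_le_nhds (U.map v)
    (le_principal_iff.2 (mem_map.2 (univ_mem' hv)))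
  have hv₀ : Tendsto v U (𝓝 v₀) := hv₀
  have hvi : ∀ i, Tendsto (fun a => v a i) U (𝓝 (v₀ i)) := fun i =>
    (tendsto_pi_nhds.1 hv₀) i
  have hdot : ∀ {x y : α → Fin n → ℝ} {x₀ y₀ : Fin n → ℝ}, Tendsto x U (𝓝 x₀) →
      Tendsto y U (𝓝 y₀) → Tendsto (fun a => x a ⬝ᵥ y a) U (𝓝 (x₀ ⬝ᵥ y₀)) := fun hx hy =>
    tendsto_finsetSum _ fun k _ => ((tendsto_pi_nhds.1 hx) k).mul ((tendsto_pi_nhds.1 hy) k)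
  have hmul : ∀ i, Tendsto (fun a => A a *ᵥ v a i) U (𝓝 (A₀ *ᵥ v₀ i)) := fun i =>
    tendsto_pi_nhds.2 fun k => hdot ((tendsto_pi_nhds.1 hA) k) (hvi i)
  -- The eigenvalue is the Rayleigh quotient of its unit eigenvector, so it converges once the
  -- vectors and matrices do.
  have hl : Tendsto l U (𝓝 fun i => v₀ i ⬝ᵥ (A₀ *ᵥ v₀ i)) := by
    refine tendsto_pi_nhds.2 fun i => (hdot (hvi i) (hmul i)).congr fun a => ?_
    rw [(h a).dotProduct_mulVec, (h a).orthonormal, if_pos rfl, mul_one]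
  refine ⟨v₀, _, ⟨fun i j => ?_, fun i => ?_⟩, hl⟩
  · refine tendsto_nhds_unique (hdot (hvi i) (hvi j)) ?_
    simp only [(h _).orthonormal]
    exact tendsto_const_nhds
  · refine tendsto_nhds_unique (hmul i) ?_
    simp only [(h _).eigen]
    exact ((tendsto_pi_nhds.1 hl) i).smul (hvi i)

end IsEigenbasis

/-- Perturbation theory of a simple second eigenvalue of a symmetric matrix when the multiplicity
of the first one is locally constant. -/
theorem orderedEigenspace_two_perturbation {α : Type*} {A : α → Matrix (Fin n) (Fin n) ℝ}
    {A₀ : Matrix (Fin n) (Fin n) ℝ} (hs : ∀ a, (A a).IsHermitian)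
    (U : Ultrafilter α) (hA : Tendsto A U (𝓝 A₀))
    (h2 : Module.finrank ℝ (orderedEigenspace A₀ 2) = 1)
    (h1 : ∀ᶠ a in (U : Filter α), Module.finrank ℝ (orderedEigenspace (A a) 1) =
      Module.finrank ℝ (orderedEigenspace A₀ 1)) :
    (∀ᶠ a in (U : Filter α), Module.finrank ℝ (orderedEigenspace (A a) 2) = 1) ∧
    ∀ (u : α → Fin n → ℝ) (w : Fin n → ℝ),
      (∀ᶠ a in (U : Filter α), u a ∈ orderedEigenspace (A a) 2) → Tendsto u U (𝓝 w) →
      w ∈ orderedEigenspace A₀ 2 := by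
  have hb := fun a => (hs a).isEigenbasis
  obtain ⟨v₀, l₀, hb₀, hl⟩ := IsEigenbasis.exists_tendsto hb U hA
  obtain ⟨m, p, hmp⟩ := hb₀.exists_isSimpleSecond h2
  have hli : ∀ i, Tendsto (fun a => (hs a).eigenvalues i) U (𝓝 (l₀ i)) := fun i =>
    (tendsto_pi_nhds.1 hl) i
  have hlt : ∀ᶠ a in (U : Filter α), ∀ i j, l₀ i < l₀ j →
      (hs a).eigenvalues i < (hs a).eigenvalues j := by
    simp only [eventually_all]
    exact fun i j hij => (hli i).eventually_lt (hli j) hij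
  have hev : ∀ᶠ a in (U : Filter α), IsSimpleSecond (hs a).eigenvalues m p := by
    filter_upwards [hlt, h1] with a ha ha1
    have : Nonempty (Fin n) := ⟨m⟩
    obtain ⟨m', hm'⟩ := Finite.exists_max (hs a).eigenvalues
    rw [(hb a).orderedEigenspace_one hm', hb₀.orderedEigenspace_one hmp.le_max,
      (hb a).finrank_eigenspace, hb₀.finrank_eigenspace] at ha1
    -- Only indices of the limiting top eigenvalue can be maximal nearby. Equal multiplicities turn
    -- this inclusion into an equality, so the top cluster does not split.
    have hsub : (Finset.univ.filter fun i => (hs a).eigenvalues i = (hs a).eigenvalues m') ⊆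
        Finset.univ.filter fun i => l₀ i = l₀ m := by
      intro i hi
      simp only [Finset.mem_filter, Finset.mem_univ, true_and] at hi ⊢
      by_contra hne
      have := ha i m (lt_of_le_of_ne (hmp.le_max i) hne)
      exact absurd (hm' m) (not_le.2 (hi ▸ this))
    have heq := Finset.eq_of_subset_of_card_le hsub ha1.ge
    have hiff : ∀ i, (hs a).eigenvalues i = (hs a).eigenvalues m' ↔ l₀ i = l₀ m := fun i => by
      have := Finset.ext_iff.1 heq i
      simpa using this
    have hmm : (hs a).eigenvalues m = (hs a).eigenvalues m' := (hiff m).2 rfl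
    refine ⟨fun i => hmm ▸ hm' i, ha _ _ hmp.lt_max, fun j hj hjp => ha _ _ ?_⟩
    exact hmp.lt_second j (fun h => hj (((hiff j).2 h).trans hmm.symm)) hjp
  refine ⟨hev.mono fun a ha => ((hb a).orderedEigenspace_two ha).2, fun u w hu hw => ?_⟩
  rw [(hb₀.orderedEigenspace_two hmp).1, Module.End.mem_eigenspace_iff, Matrix.toLin'_apply]
  have t1 : Tendsto (fun a => A a *ᵥ u a) U (𝓝 (A₀ *ᵥ w)) :=
    tendsto_pi_nhds.2 fun k => tendsto_finsetSum Finset.univ fun i _ =>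
      ((tendsto_pi_nhds.1 ((tendsto_pi_nhds.1 hA) k)) i).mul ((tendsto_pi_nhds.1 hw) i)
  refine tendsto_nhds_unique t1 (((hli p).smul hw).congr' ?_)
  filter_upwards [hev, hu] with a ha hua
  rw [((hb a).orderedEigenspace_two ha).1, Module.End.mem_eigenspace_iff,
    Matrix.toLin'_apply] at hua
  exact hua.symm

/-- A positive power is strictly increasing on `[0, ∞)`, where the spectrum of `Pᵀ P` lies. -/
theorem orderedEigenspace_cfc_rpow (P : Matrix (Fin n) (Fin n) ℝ) {r : ℝ} (hr : 0 < r) (j : ℕ) :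
    orderedEigenspace (cfc (fun a : ℝ => a ^ r) (Pᵀ * P)) j = orderedEigenspace (Pᵀ * P) j := by
  have hp : (Pᵀ * P).PosSemidef := Matrix.posSemidef_conjTranspose_mul_self P
  refine hp.1.isEigenbasis.orderedEigenspace_comp (hp.1.isEigenbasis_cfc _) ?_ j
  rintro _ ⟨i, rfl⟩ _ ⟨k, rfl⟩ hik
  exact Real.rpow_lt_rpow (hp.eigenvalues_nonneg i) hik hr

end Spectral

/-! ### Gronwall's inequality and linear differential equations -/

/-- A two-sided form of Gronwall's inequality. -/
theorem norm_le_mul_exp_of_norm_deriv_le {E : Type*} [NormedAddCommGroup E] [NormedSpace ℝ E]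
    {f f' : ℝ → E} {K ε T : ℝ} (hK : 1 ≤ K) (hε : 0 ≤ ε)
    (hf : ∀ s, |s| ≤ T → HasDerivAt f (f' s) s)
    (hb : ∀ s, |s| ≤ T → ‖f' s‖ ≤ K * ‖f s‖ + ε) {s : ℝ} (hs : |s| ≤ T) :
    ‖f s‖ ≤ (‖f 0‖ + ε) * Real.exp (K * T) := by
  have key : ∀ {g g' : ℝ → E}, (∀ s, |s| ≤ T → HasDerivAt g (g' s) s) →
      (∀ s, |s| ≤ T → ‖g' s‖ ≤ K * ‖g s‖ + ε) → ∀ s ∈ Icc 0 T,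
      ‖g s‖ ≤ (‖g 0‖ + ε) * Real.exp (K * T) := by
    intro g g' hg hgb s hs
    have habs : ∀ r ∈ Icc 0 T, |r| ≤ T := fun r hr => by rw [abs_of_nonneg hr.1]; exact hr.2
    have h := norm_le_gronwallBound_of_norm_deriv_right_le (a := 0) (b := T) (δ := ‖g 0‖)
      (fun r hr => (hg r (habs r hr)).continuousAt.continuousWithinAt)
      (fun r hr => (hg r (habs r (Ico_subset_Icc_self hr))).hasDerivWithinAt) le_rfl
      (fun r hr => hgb r (habs r (Ico_subset_Icc_self hr))) s hs
    rw [gronwallBound_of_K_ne_0 (by positivity), sub_zero] at h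
    have h1 : ε / K ≤ ε := div_le_self hε hK
    have h2 : Real.exp (K * s) ≤ Real.exp (K * T) :=
      Real.exp_le_exp.2 (mul_le_mul_of_nonneg_left hs.2 (by positivity))
    have h3 : 1 ≤ Real.exp (K * s) := Real.one_le_exp (mul_nonneg (by positivity) hs.1)
    calc ‖g s‖ ≤ ‖g 0‖ * Real.exp (K * s) + ε / K * (Real.exp (K * s) - 1) := h
      _ ≤ ‖g 0‖ * Real.exp (K * T) + ε * Real.exp (K * T) := by
        gcongr
        linarith
      _ = _ := by ring
  rcases le_total 0 s with h0 | h0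
  · exact key hf hb s ⟨h0, (abs_of_nonneg h0) ▸ hs⟩
  -- Negative times follow by time reversal.
  · have := key (g := fun r => f (-r)) (g' := fun r => -f' (-r))
      (fun r hr => by
        have := (hf (-r) (by rwa [abs_neg])).scomp r (hasDerivAt_neg r)
        simpa using! this)
      (fun r hr => by simpa using hb (-r) (by rwa [abs_neg])) (-s)
      ⟨by linarith, (abs_of_nonpos h0) ▸ hs⟩
    simpa using this

/-- Solvability of linear differential equations in a Banach algebra. -/
theorem exists_hasDerivAt_linear_ode {𝔸 : Type*} [NormedRing 𝔸] [NormedAlgebra ℝ 𝔸]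
    [CompleteSpace 𝔸] {a : ℝ → 𝔸} (ha : Continuous a) (T : ℝ) (hT : 0 < T) :
    ∃ V : ℝ → 𝔸, V 0 = 1 ∧ ∀ s, |s| < T → HasDerivAt V (a s * V s) s := by
  obtain ⟨C, hC⟩ := (isCompact_Icc (a := -T) (b := T)).exists_bound_of_continuousOn ha.continuousOn
  have hC' : ∀ s, |s| < T → ‖a s‖ ≤ C := fun s hs => hC s (abs_le.1 hs.le)
  have hC0 : 0 ≤ C := (norm_nonneg _).trans (hC' 0 (by simpa using hT))
  -- Terms of the Picard series: iterated integrals of `a`, bounded by those of an exponential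
  -- series. The solution is their sum.
  let W : ℕ → ℝ → 𝔸 := fun n =>
    Nat.rec (fun _ => 1) (fun _ v s => ∫ r in (0 : ℝ)..s, a r * v r) n
  have hW0 : W 0 = fun _ => 1 := rfl
  have hWs : ∀ n, W (n + 1) = fun s => ∫ r in (0 : ℝ)..s, a r * W n r := fun n => rfl
  have hcont : ∀ n, Continuous (W n) := by
    intro n
    induction n with
    | zero => exact continuous_const
    | succ n ih =>
      rw [hWs]
      exact intervalIntegral.continuous_primitive
        (fun _ _ => (ha.mul ih).intervalIntegrable _ _) 0
  have hder : ∀ n s, HasDerivAt (W (n + 1)) (a s * W n s) s := fun n s =>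
    ((ha.mul (hcont n)).integral_hasStrictDerivAt 0 s).hasDerivAt
  have hbd : ∀ n s, |s| < T → ‖W n s‖ ≤ ‖(1 : 𝔸)‖ * (C * |s|) ^ n / n.factorial := by
    intro n
    induction n with
    | zero => intro s _; simp [hW0]
    | succ n ih =>
      intro s hs
      have hint : ∀ r ∈ uIoc 0 s, |r| < T := fun r hr => by
        rcases le_total 0 s with h | h
        · rw [uIoc_of_le h] at hr
          rw [abs_of_pos hr.1]
          exact hr.2.trans_lt ((le_abs_self s).trans_lt hs)
        · rw [uIoc_of_ge h] at hr
          rw [abs_of_nonpos hr.2]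
          rw [abs_of_nonpos h] at hs
          linarith [hr.1]
      have hci : IntegrableOn (fun r : ℝ => C * ‖(1 : 𝔸)‖ * C ^ n / n.factorial * |r - 0| ^ n)
          (uIoc 0 s) := by
        apply Continuous.integrableOn_uIoc
        fun_prop
      calc ‖W (n + 1) s‖ ≤ ∫ r in uIoc 0 s, ‖a r * W n r‖ := by
            rw [hWs]; exact intervalIntegral.norm_integral_le_integral_norm_uIoc
        _ ≤ ∫ r in uIoc 0 s, C * ‖(1 : 𝔸)‖ * C ^ n / n.factorial * |r - 0| ^ n := by
            refine setIntegral_mono_on ?_ hci measurableSet_uIoc fun r hr => ?_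
            · exact ((ha.mul (hcont n)).norm).integrableOn_uIoc
            · calc ‖a r * W n r‖ ≤ ‖a r‖ * ‖W n r‖ := norm_mul_le _ _
                _ ≤ C * (‖(1 : 𝔸)‖ * (C * |r|) ^ n / n.factorial) :=
                  mul_le_mul (hC' r (hint r hr)) (ih r (hint r hr)) (norm_nonneg _) hC0
                _ = _ := by rw [sub_zero, mul_pow]; ring
        _ = _ := by
            rw [integral_const_mul, integral_pow_abs_sub_uIoc, sub_zero, Nat.factorial_succ]
            push_cast
            field_simp
            ring
  have hbd' : ∀ n s, |s| < T → ‖W n s‖ ≤ ‖(1 : 𝔸)‖ * ((C * T) ^ n / n.factorial) := by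
    intro n s hs
    refine (hbd n s hs).trans ?_
    rw [mul_div_assoc]
    gcongr
  have hsum : Summable fun n : ℕ => ‖(1 : 𝔸)‖ * ((C * T) ^ n / n.factorial) :=
    (Real.summable_pow_div_factorial (C * T)).mul_left _
  have hsW : ∀ s, |s| < T → Summable fun n => W n s := fun s hs =>
    Summable.of_norm_bounded hsum fun n => hbd' n s hs
  have hioo : ∀ s : ℝ, s ∈ Ioo (-T) T ↔ |s| < T := fun s => abs_lt.symm
  refine ⟨fun s => 1 + ∑' n, W (n + 1) s, ?_, fun s hs => ?_⟩
  · simp [hWs]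
  · have hd := hasDerivAt_tsum_of_isPreconnected (t := Ioo (-T) T)
      (g := fun n s => W (n + 1) s) (g' := fun n s => a s * W n s)
      (hsum.mul_left C) isOpen_Ioo isPreconnected_Ioo
      (fun n y _ => hder n y)
      (fun n y hy => (norm_mul_le _ _).trans (mul_le_mul (hC' y ((hioo y).1 hy))
        (hbd' n y ((hioo y).1 hy)) (norm_nonneg _) hC0))
      (y₀ := 0) ((hioo 0).2 (by simpa using hT))
      (by simp [hWs, summable_zero]) ((hioo s).2 hs)
    have := hd.const_add 1
    rw [(hsW s hs).tsum_mul_left, (hsW s hs).tsum_eq_zero_add] at this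
    exact this

/-- Linear differential equations in a Banach algebra depending on a parameter. -/
theorem exists_hasDerivAt_linear_ode_param {𝔸 P : Type*} [NormedRing 𝔸] [NormedAlgebra ℝ 𝔸]
    [CompleteSpace 𝔸] [TopologicalSpace P] [CompactSpace P] (a : C(ℝ × P, 𝔸)) (T : ℝ)
    (hT : 0 < T) :
    ∃ V : ℝ → C(P, 𝔸), (∀ p, V 0 p = 1) ∧
      ∀ s, |s| < T → ∀ p, HasDerivAt (fun r => V r p) (a (s, p) * V s p) s := by
  -- Solving in the Banach algebra `C(P, 𝔸)` makes continuity in the parameter automatic; evaluation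
  -- at `p` recovers the pointwise equation.
  obtain ⟨V, hV0, hV⟩ := exists_hasDerivAt_linear_ode (a := a.curry) a.curry.continuous T hT
  refine ⟨V, fun p => by rw [hV0]; rfl, fun s hs p => ?_⟩
  have h1 := (ContinuousMap.evalCLM (M := 𝔸) ℝ p).hasFDerivAt (x := V s)
  exact h1.comp_hasDerivAt s (hV s hs)

/-! ### Flows of Whitney differentiable fields on compact sets -/

/-- A time-dependent vector field `G` on a compact set `X`, with a Whitney derivative `A`, and the
evolution `φ s b x` over time `s` of the point `x` at time `b`. -/
structure WhitneyFlow {E : Type*} [NormedAddCommGroup E] [NormedSpace ℝ E] {X : Set E}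
    (G : ℝ → X → E) (A : ℝ → X → E →L[ℝ] E) (φ : ℝ → ℝ → X → X) : Prop where
  continuous : Continuous fun p : ℝ × X => G p.1 p.2
  continuous_deriv : Continuous fun p : ℝ × X => A p.1 p.2
  whitney : ∀ Q ε : ℝ, 0 < ε → ∃ ρ > 0, ∀ t, |t| ≤ Q → ∀ y y' : X, ‖(y' - y : E)‖ < ρ →
    ‖G t y' - G t y - A t y (y' - y)‖ ≤ ε * ‖(y' - y : E)‖
  zero : ∀ b x, φ 0 b x = x
  hasDerivAt : ∀ s b x, HasDerivAt (fun r => (φ r b x : E)) (G (s + b) (φ s b x)) s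

namespace WhitneyFlow

variable {E : Type*} [NormedAddCommGroup E] [NormedSpace ℝ E] {X : Set E}
  {G : ℝ → X → E} {A : ℝ → X → E →L[ℝ] E} {φ : ℝ → ℝ → X → X}

/-- `X` need not be convex, so the Lipschitz bound does not come from the mean value theorem: nearby
points use the Whitney estimate, and points at distance at least `ρ` use the sup bound of `G`. -/
theorem exists_bound [CompactSpace X] (h : WhitneyFlow G A φ) (Q : ℝ) :
    ∃ K, 1 ≤ K ∧ ∀ t, |t| ≤ Q → (∀ y, ‖G t y‖ ≤ K) ∧ (∀ y, ‖A t y‖ ≤ K) ∧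
      ∀ y y' : X, ‖G t y' - G t y‖ ≤ K * ‖(y' - y : E)‖ := by
  have hcomp : IsCompact (Icc (-Q) Q ×ˢ (univ : Set X)) := isCompact_Icc.prod isCompact_univ
  obtain ⟨C₁, h₁⟩ := hcomp.exists_bound_of_continuousOn h.continuous.continuousOn
  obtain ⟨C₂, h₂⟩ := hcomp.exists_bound_of_continuousOn h.continuous_deriv.continuousOn
  obtain ⟨ρ, hρ, hw⟩ := h.whitney Q 1 one_pos
  have h₁' : ∀ t, |t| ≤ Q → ∀ y, ‖G t y‖ ≤ |C₁| := fun t ht y =>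
    (h₁ (t, y) ⟨abs_le.1 ht, mem_univ _⟩).trans (le_abs_self _)
  have h₂' : ∀ t, |t| ≤ Q → ∀ y, ‖A t y‖ ≤ |C₂| := fun t ht y =>
    (h₂ (t, y) ⟨abs_le.1 ht, mem_univ _⟩).trans (le_abs_self _)
  have hp : 0 ≤ 2 * |C₁| / ρ := by positivity
  refine ⟨1 + |C₁| + |C₂| + 2 * |C₁| / ρ, by linarith [abs_nonneg C₁, abs_nonneg C₂],
    fun t ht => ⟨fun y => ?_, fun y => ?_, fun y y' => ?_⟩⟩
  · linarith [h₁' t ht y, abs_nonneg C₂]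
  · linarith [h₂' t ht y, abs_nonneg C₁]
  · rcases lt_or_ge ‖(y' - y : E)‖ ρ with hlt | hge
    · have e : G t y' - G t y = (G t y' - G t y - A t y (y' - y)) + A t y (y' - y) := by abel
      rw [e]
      have a1 := hw t ht y y' hlt
      have a2 := (A t y).le_of_opNorm_le (h₂' t ht y) (y' - y : E)
      refine (norm_add_le _ _).trans ((add_le_add a1 a2).trans ?_)
      rw [← add_mul]
      exact mul_le_mul_of_nonneg_right (by linarith [abs_nonneg C₁]) (norm_nonneg _)
    · calc ‖G t y' - G t y‖ ≤ |C₁| + |C₁| := (norm_sub_le _ _).trans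
            (add_le_add (h₁' t ht y') (h₁' t ht y))
        _ = 2 * |C₁| / ρ * ρ := by field_simp; ring
        _ ≤ 2 * |C₁| / ρ * ‖(y' - y : E)‖ := by gcongr
        _ ≤ _ := by
          gcongr
          linarith [abs_nonneg C₁, abs_nonneg C₂]

/-- Flow maps are Lipschitz, uniformly on bounded time intervals. -/
theorem exists_lipschitz [CompactSpace X] (h : WhitneyFlow G A φ) (T R : ℝ) :
    ∃ L, 0 < L ∧ ∀ s b, |s| ≤ T → |b| ≤ R → ∀ x x' : X,
      ‖(φ s b x' - φ s b x : E)‖ ≤ L * ‖(x' - x : E)‖ := by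
  obtain ⟨K, hK, hb⟩ := h.exists_bound (T + R)
  refine ⟨Real.exp (K * T), Real.exp_pos _, fun s b hs hbR x x' => ?_⟩
  have := norm_le_mul_exp_of_norm_deriv_le (f := fun s => (φ s b x' - φ s b x : E)) (ε := 0)
    hK le_rfl (T := T) (fun s _ => (h.hasDerivAt s b x').sub (h.hasDerivAt s b x))
    (fun s hs => by
      simpa using (hb (s + b) ((abs_add_le _ _).trans (add_le_add hs hbR))).2.2 _ _) hs
  rw [h.zero, h.zero, add_zero] at this
  linarith

/-- Both sides solve the same equation in `s` with the same initial value, and Gronwall's inequality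
gives uniqueness. -/
theorem cocycle [CompactSpace X] (h : WhitneyFlow G A φ) (s a b : ℝ) (x : X) :
    φ s (a + b) (φ a b x) = φ (s + a) b x := by
  obtain ⟨K, hK, hb⟩ := h.exists_bound (|s| + |a + b|)
  have := norm_le_mul_exp_of_norm_deriv_le
    (f := fun s => (φ s (a + b) (φ a b x) - φ (s + a) b x : E)) (ε := 0)
    hK le_rfl (T := |s|) (fun s _ => (h.hasDerivAt s _ _).sub
      ((h.hasDerivAt (s + a) b x).comp_add_const s a))
    (fun r hr => by
      have := (hb (r + (a + b)) ((abs_add_le _ _).trans (add_le_add_left hr _))).2.2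
      rw [add_assoc r a b]
      simpa using this _ _) (le_refl |s|)
  rw [h.zero] at this
  simp only [zero_add, sub_self, norm_zero, add_zero, zero_mul, norm_le_zero_iff] at this
  exact Subtype.ext (sub_eq_zero.1 this)

theorem leftInverse [CompactSpace X] (h : WhitneyFlow G A φ) (s b : ℝ) :
    Function.LeftInverse (φ (-s) (s + b)) (φ s b) := fun x => by
  rw [h.cocycle, neg_add_cancel, h.zero]

theorem rightInverse [CompactSpace X] (h : WhitneyFlow G A φ) (s b : ℝ) :
    Function.RightInverse (φ (-s) (s + b)) (φ s b) := fun x => by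
  have := h.leftInverse (-s) (s + b) x
  rwa [neg_neg, neg_add_cancel_left] at this

theorem exists_lipschitz_joint [CompactSpace X] (h : WhitneyFlow G A φ) (T R : ℝ) :
    ∃ L, 0 < L ∧ ∀ s s' b b', |s| ≤ T → |s'| ≤ T → |b| ≤ R → |b'| ≤ R → ∀ x x' : X,
      ‖(φ s' b' x' - φ s b x : E)‖ ≤ L * (|s' - s| + |b' - b| + ‖(x' - x : E)‖) := by
  obtain ⟨K, hK, hb⟩ := h.exists_bound (T + 2 * R + R)
  obtain ⟨L, hL, hl⟩ := h.exists_lipschitz T R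
  have htime : ∀ r r' b, |r| ≤ T + 2 * R → |r'| ≤ T + 2 * R → |b| ≤ R → ∀ x : X,
      ‖(φ r' b x - φ r b x : E)‖ ≤ K * |r' - r| := by
    intro r r' b hr hr' hbR x
    have := (convex_Icc (-(T + 2 * R)) (T + 2 * R)).norm_image_sub_le_of_norm_hasDerivWithin_le
      (f := fun r => (φ r b x : E)) (C := K)
      (fun q _ => (h.hasDerivAt q b x).hasDerivWithinAt)
      (fun q hq => (hb (q + b)
        ((abs_add_le _ _).trans (add_le_add (abs_le.2 hq) hbR))).1 _)
      (abs_le.1 hr) (abs_le.1 hr')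
    simpa using this
  refine ⟨K + L * K + L, by positivity, fun s s' b b' hs hs' hbR hbR' x x' => ?_⟩
  have hbb : |b' - b| ≤ 2 * R := (abs_sub _ _).trans (by linarith)
  have hT0 : 0 ≤ T := (abs_nonneg _).trans hs
  have hR0 : 0 ≤ R := (abs_nonneg _).trans hbR
  -- The cocycle identity trades a change of base time for a change of duration and of initial
  -- point. Durations thus reach `T + 2 * R`.
  have e1 : φ s b' (φ (b' - b) b x) = φ (s + (b' - b)) b x := by
    have := h.cocycle s (b' - b) b x
    rwa [sub_add_cancel] at this
  have i1 : ‖(φ s' b' x' - φ s b' x' : E)‖ ≤ K * |s' - s| :=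
    htime s s' b' (by linarith) (by linarith) hbR' x'
  have i2 : ‖(φ s b' x' - φ s b' x : E)‖ ≤ L * ‖(x' - x : E)‖ := hl s b' hs hbR' x x'
  have i3 : ‖(φ s b' x - φ s b' (φ (b' - b) b x) : E)‖ ≤ L * (K * |b' - b|) := by
    refine (hl s b' hs hbR' _ _).trans (mul_le_mul_of_nonneg_left ?_ hL.le)
    have := htime (b' - b) 0 b (by linarith) (by simp; linarith) hbR x
    rw [h.zero, zero_sub, abs_neg] at this
    exact this
  have i4 : ‖(φ (s + (b' - b)) b x - φ s b x : E)‖ ≤ K * |b' - b| := by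
    have := htime s (s + (b' - b)) b (by linarith)
      ((abs_add_le _ _).trans (add_le_add hs hbb)) hbR x
    rwa [add_sub_cancel_left] at this
  have e : (φ s' b' x' - φ s b x : E) = (φ s' b' x' - φ s b' x' : E) +
      (φ s b' x' - φ s b' x : E) + (φ s b' x - φ s b' (φ (b' - b) b x) : E) +
      (φ (s + (b' - b)) b x - φ s b x : E) := by rw [e1]; abel
  rw [e]
  have n1 := norm_add_le (((φ s' b' x' - φ s b' x' : E) +
      (φ s b' x' - φ s b' x : E)) + (φ s b' x - φ s b' (φ (b' - b) b x) : E))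
      (φ (s + (b' - b)) b x - φ s b x : E)
  have n2 := norm_add_le ((φ s' b' x' - φ s b' x' : E) +
      (φ s b' x' - φ s b' x : E)) (φ s b' x - φ s b' (φ (b' - b) b x) : E)
  have n3 := norm_add_le (φ s' b' x' - φ s b' x' : E) (φ s b' x' - φ s b' x : E)
  have p1 : 0 ≤ L * K * |s' - s| := by positivity
  have p2 : 0 ≤ L * |s' - s| := by positivity
  have p3 : 0 ≤ L * |b' - b| := by positivity
  have p4 : 0 ≤ (K + L * K) * ‖(x' - x : E)‖ := by positivity
  nlinarith

theorem continuous_flow [CompactSpace X] (h : WhitneyFlow G A φ) :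
    Continuous fun p : ℝ × ℝ × X => φ p.1 p.2.1 p.2.2 := by
  rw [Topology.IsInducing.subtypeVal.continuous_iff, continuous_iff_continuousAt]
  rintro ⟨s, b, x⟩
  obtain ⟨L, hL, hl⟩ := h.exists_lipschitz_joint (|s| + 1) (|b| + 1)
  rw [ContinuousAt, tendsto_iff_norm_sub_tendsto_zero]
  have ht : Tendsto (fun p : ℝ × ℝ × X =>
      L * (|p.1 - s| + |p.2.1 - b| + ‖(p.2.2 - x : E)‖)) (𝓝 (s, b, x)) (𝓝 0) := by
    have : Continuous fun p : ℝ × ℝ × X =>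
      L * (|p.1 - s| + |p.2.1 - b| + ‖(p.2.2 - x : E)‖) := by fun_prop
    simpa using this.tendsto (s, b, x)
  refine squeeze_zero' (.of_forall fun _ => norm_nonneg _) ?_ ht
  have e1 : ∀ᶠ p : ℝ × ℝ × X in 𝓝 (s, b, x), |p.1| < |s| + 1 :=
    (continuous_fst.abs.tendsto (s, b, x)).eventually (gt_mem_nhds (lt_add_one _))
  have e2 : ∀ᶠ p : ℝ × ℝ × X in 𝓝 (s, b, x), |p.2.1| < |b| + 1 :=
    (continuous_snd.fst.abs.tendsto (s, b, x)).eventually (gt_mem_nhds (lt_add_one _))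
  filter_upwards [e1, e2] with p h1 h2
  exact hl s p.1 b p.2.1 (by linarith) h1.le (by linarith) h2.le x p.2.2

/-- Continuous differentiability of the flow, in the sense of Whitney, with respect to the initial
point. -/
theorem exists_whitney_deriv [CompleteSpace E] [CompactSpace X] (h : WhitneyFlow G A φ) (s R : ℝ) :
    ∃ V : ℝ → X → E →L[ℝ] E,
      ContinuousOn (fun p : ℝ × X => V p.1 p.2) (Icc (-R) R ×ˢ univ) ∧
      ∀ b, |b| ≤ R → ∀ ε > 0, ∃ ρ > 0, ∀ x x' : X, ‖(x' - x : E)‖ < ρ →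
        ‖(φ s b x' - φ s b x : E) - V b x (x' - x)‖ ≤ ε * ‖(x' - x : E)‖ := by
  let a : C(ℝ × (Icc (-R) R × X), E →L[ℝ] E) :=
    ⟨fun p => A (p.1 + p.2.1) (φ p.1 p.2.1 p.2.2),
      h.continuous_deriv.comp ((continuous_fst.add (continuous_subtype_val.comp
        continuous_snd.fst)).prodMk (h.continuous_flow.comp (continuous_fst.prodMk
        ((continuous_subtype_val.comp continuous_snd.fst).prodMk continuous_snd.snd))))⟩
  obtain ⟨V, hV0, hV⟩ := exists_hasDerivAt_linear_ode_param a (|s| + 1) (by positivity)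
  have hVp : ∀ p r, |r| ≤ |s| → HasDerivAt (fun r => V r p)
      (A (r + p.1) (φ r p.1 p.2) * V r p) r := fun p r hr => hV r (by linarith) p
  classical
  -- The base time is confined to `[-R, R]` to make the parameter space compact; the value outside
  -- is arbitrary.
  let W : ℝ → X → E →L[ℝ] E := fun b x =>
    if hb : b ∈ Icc (-R) R then V s (⟨b, hb⟩, x) else 0
  refine ⟨W, ?_, fun b hb ε hε => ?_⟩
  · rw [continuousOn_iff_continuous_domRestrict]
    have : ((Icc (-R) R ×ˢ univ).domRestrict fun p : ℝ × X => W p.1 p.2) =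
        fun q => V s (⟨q.1.1, q.2.1⟩, q.1.2) := by
      ext1 q
      exact dif_pos q.2.1
    rw [this]
    exact (V s).continuous.comp (by fun_prop)
  obtain ⟨K, hK, hB⟩ := h.exists_bound (|s| + R)
  obtain ⟨L, hL, hl⟩ := h.exists_lipschitz |s| R
  obtain ⟨ρ, hρ, hw⟩ := h.whitney (|s| + R) (ε / (L * Real.exp (K * |s|))) (by positivity)
  refine ⟨ρ / L, by positivity, fun x x' hx => ?_⟩
  have hmem : b ∈ Icc (-R) R := abs_le.1 hb
  have hW : W b x = V s (⟨b, hmem⟩, x) := dif_pos hmem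
  rw [hW]
  -- The linearisation error vanishes at time zero and solves the variational equation up to the
  -- Whitney remainder of `G`. Dividing `ε` by `L * Real.exp (K * |s|)` beforehand makes the
  -- Gronwall bound exactly `ε * ‖x' - x‖`.
  have hgr := norm_le_mul_exp_of_norm_deriv_le
    (f := fun r => (φ r b x' - φ r b x : E) - V r (⟨b, hmem⟩, x) (x' - x))
    (ε := ε / (L * Real.exp (K * |s|)) * (L * ‖(x' - x : E)‖)) hK (by positivity) (T := |s|)
    (fun r hr => ((h.hasDerivAt r b x').sub (h.hasDerivAt r b x)).sub
      ((hVp (⟨b, hmem⟩, x) r hr).clm_apply (hasDerivAt_const r (x' - x : E))))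
    (fun r hr => by
      have ht : |r + b| ≤ |s| + R := (abs_add_le _ _).trans (add_le_add hr hb)
      have hlip := hl r b hr hb x x'
      have h1 := hw (r + b) ht (φ r b x) (φ r b x') (by
        refine hlip.trans_lt ?_
        rwa [lt_div_iff₀' hL] at hx)
      have h2 := (A (r + b) (φ r b x)).le_of_opNorm_le ((hB _ ht).2.1 _)
        ((φ r b x' - φ r b x : E) - V r (⟨b, hmem⟩, x) (x' - x))
      have e : G (r + b) (φ r b x') - G (r + b) (φ r b x) -
          ((A (r + b) (φ r b x) * V r (⟨b, hmem⟩, x)) (x' - x : E) +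
            (V r (⟨b, hmem⟩, x)) 0) =
          A (r + b) (φ r b x) ((φ r b x' - φ r b x : E) - V r (⟨b, hmem⟩, x) (x' - x)) +
          (G (r + b) (φ r b x') - G (r + b) (φ r b x) -
            A (r + b) (φ r b x) (φ r b x' - φ r b x : E)) := by
        rw [map_sub (A (r + b) (φ r b x)) (φ r b x' - φ r b x : E), map_zero,
          mul_apply_eq_comp]
        abel
      refine (congrArg norm e).trans_le ((norm_add_le _ _).trans (add_le_add h2 (h1.trans ?_)))
      gcongr) le_rfl
  refine hgr.trans (le_of_eq ?_)
  rw [hV0]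
  simp only [h.zero, one_apply_eq_self, sub_self, norm_zero,
    zero_add]
  have := Real.exp_pos (K * |s|)
  field_simp

end WhitneyFlow

/-! ### Gram operators and left inverses -/

theorem det_ne_zero_of_isUnit {E : Type*} [NormedAddCommGroup E] [NormedSpace ℝ E]
    {C : E →L[ℝ] E} (hC : IsUnit C) : C.det ≠ 0 :=
  ((hC.map ContinuousLinearMap.toLinearMapRingHom).map LinearMap.det).ne_zero

section PseudoInverse

variable {E E' : Type*} [NormedAddCommGroup E] [InnerProductSpace ℝ E] [CompleteSpace E]
  [NormedAddCommGroup E'] [InnerProductSpace ℝ E'] [CompleteSpace E']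

/-- The Gram operator `T† T`. -/
noncomputable def gramOp (T : E →L[ℝ] E') : E →L[ℝ] E :=
  ContinuousLinearMap.adjoint T ∘L T

theorem inner_gramOp (T : E →L[ℝ] E') (x y : E) : inner ℝ x (gramOp T y) = inner ℝ (T x) (T y) := by
  exact ContinuousLinearMap.adjoint_inner_right T x (T y)

theorem continuous_gramOp : Continuous (gramOp : (E →L[ℝ] E') → (E →L[ℝ] E)) := by
  exact (ContinuousLinearMap.adjoint (𝕜 := ℝ) (E := E) (F := E')).continuous.clm_comp continuous_id

theorem gramOp_comp (T : E →L[ℝ] E') (C : E →L[ℝ] E) :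
      gramOp (T ∘L C) = ContinuousLinearMap.adjoint C * (gramOp T * C) := by
  simp only [gramOp, ContinuousLinearMap.adjoint_comp]
  rfl

variable [FiniteDimensional ℝ E]

theorem isUnit_gramOp {T : E →L[ℝ] E'} (hT : Function.Injective T) : IsUnit (gramOp T) := by
  have hinj : Function.Injective (gramOp T) := by
    rw [injective_iff_map_eq_zero]
    intro x hx
    have h := inner_gramOp T x x
    rw [hx, inner_zero_right] at h
    exact (map_eq_zero_iff T hT).1 (inner_self_eq_zero.1 h.symm)
  exact ContinuousLinearMap.isUnit_iff_bijective.2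
    ⟨hinj, (LinearMap.injective_iff_surjective (f := (gramOp T : E →ₗ[ℝ] E))).1 hinj⟩

/-- The left inverse `(T† T)⁻¹ T†` of an injective operator `T`. -/
noncomputable def leftInv (T : E →L[ℝ] E') : E' →L[ℝ] E :=
  Ring.inverse (gramOp T) ∘L ContinuousLinearMap.adjoint T

theorem leftInv_comp {T : E →L[ℝ] E'} (hT : Function.Injective T) :
    leftInv T ∘L T = ContinuousLinearMap.id ℝ E :=
  Ring.inverse_mul_cancel _ (isUnit_gramOp hT)

/-- The transformation rule under a change of coordinates `C`; it makes the Whitney derivative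
independent of the chart. -/
theorem comp_leftInv_comp {T : E →L[ℝ] E'} (hT : Function.Injective T) {C : E →L[ℝ] E}
    (hC : IsUnit C) : C ∘L leftInv (T ∘L C) = leftInv T := by
  obtain ⟨c, rfl⟩ := hC
  obtain ⟨u, hu⟩ := isUnit_gramOp hT
  have hs : IsUnit (ContinuousLinearMap.adjoint (c : E →L[ℝ] E)) := c.isUnit.star
  obtain ⟨a, ha⟩ := hs
  have key : (c : E →L[ℝ] E) * (Ring.inverse (gramOp (T ∘L (c : E →L[ℝ] E))) *
      ContinuousLinearMap.adjoint (c : E →L[ℝ] E)) = Ring.inverse (gramOp T) := by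
    rw [gramOp_comp, ← hu, ← ha, ← Units.val_mul, ← Units.val_mul, Ring.inverse_unit,
      Ring.inverse_unit, ← Units.val_mul, ← Units.val_mul]
    congr 1
    group
  have e : (c : E →L[ℝ] E) ∘L leftInv (T ∘L (c : E →L[ℝ] E)) =
      ((c : E →L[ℝ] E) * (Ring.inverse (gramOp (T ∘L (c : E →L[ℝ] E))) *
      ContinuousLinearMap.adjoint (c : E →L[ℝ] E))) ∘L ContinuousLinearMap.adjoint T := by
    simp only [leftInv, ContinuousLinearMap.adjoint_comp]
    rfl
  rw [e, key]
  rfl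

theorem continuousAt_leftInv {T : E →L[ℝ] E'} (hT : Function.Injective T) :
    ContinuousAt (leftInv : (E →L[ℝ] E') → (E' →L[ℝ] E)) T := by
  obtain ⟨u, hu⟩ := isUnit_gramOp hT
  have h1 : ContinuousAt (fun S : E →L[ℝ] E' => Ring.inverse (gramOp S)) T := by
    have := NormedRing.inverse_continuousAt u
    rw [hu] at this
    exact this.comp continuous_gramOp.continuousAt
  exact h1.clm_comp
    (ContinuousLinearMap.adjoint (𝕜 := ℝ) (E := E) (F := E')).continuous.continuousAt

theorem det_gramOp_comp (T : E →L[ℝ] E') (C : E →L[ℝ] E) :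
    (gramOp (T ∘L C)).det = C.det ^ 2 * (gramOp T).det := by
  have h : (ContinuousLinearMap.adjoint C).det = C.det := by
    have hm := LinearMap.toMatrix_adjoint (stdOrthonormalBasis ℝ E) (stdOrthonormalBasis ℝ E)
      (C : E →ₗ[ℝ] E)
    have hd := congrArg Matrix.det hm
    rw [Matrix.det_conjTranspose, star_trivial, LinearMap.det_toMatrix,
      LinearMap.det_toMatrix] at hd
    exact hd
  rw [gramOp_comp]
  have hm : ∀ P Q : E →L[ℝ] E, (P * Q).det = P.det * Q.det := fun P Q =>
    map_mul LinearMap.det (P : E →ₗ[ℝ] E) (Q : E →ₗ[ℝ] E)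
  rw [hm, hm, h]
  ring

end PseudoInverse

/-! ### Derivatives and Jacobians in a fixed chart -/

section Chart

variable {d D : ℕ} {H : Type*} [TopologicalSpace H]
  {I : ModelWithCorners ℝ (EuclideanSpace ℝ (Fin d)) H}
  {X : Set (EuclideanSpace ℝ (Fin D))} [ChartedSpace H X]

theorem gramDet_eq_det_gramOp (g : X → EuclideanSpace ℝ (Fin D)) (x : X) :
    gramDet I g x = (gramOp (ambientDeriv I g x)).det := by
  let b := EuclideanSpace.basisFun (Fin d) ℝ
  have h : (gramOp (ambientDeriv I g x)).det =
      (LinearMap.toMatrix b.toBasis b.toBasis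
        (gramOp (ambientDeriv I g x) : EuclideanSpace ℝ (Fin d) →ₗ[ℝ] _)).det :=
    (LinearMap.det_toMatrix _ _).symm
  rw [h, gramDet]
  congr 1
  ext i j
  rw [LinearMap.toMatrix_apply, Matrix.of_apply, ← inner_gramOp]
  simp [b, EuclideanSpace.inner_single_left]

variable (I) in
/-- The derivative at `u` of the inverse of the chart at `x₀`. -/
noncomputable def chartSymmDeriv (x₀ : X) (u : EuclideanSpace ℝ (Fin d)) :
    EuclideanSpace ℝ (Fin d) →L[ℝ] EuclideanSpace ℝ (Fin d) :=
  mfderivWithin 𝓘(ℝ, EuclideanSpace ℝ (Fin d)) I (extChartAt I x₀).symm (range I) u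

theorem isUnit_chartSymmDeriv [IsManifold I 1 X] (x₀ : X) {u : EuclideanSpace ℝ (Fin d)}
    (hu : u ∈ (extChartAt I x₀).target) : IsUnit (chartSymmDeriv I x₀ u) := by
  obtain ⟨e, he⟩ := isInvertible_mfderivWithin_extChartAt_symm hu
  refine ⟨ContinuousLinearEquiv.toUnit e, ?_⟩
  exact he

theorem hasFDerivWithinAt_comp_extChartAt_symm [IsManifold I 1 X]
    {g : X → EuclideanSpace ℝ (Fin D)} (x₀ : X) {u : EuclideanSpace ℝ (Fin d)}
    (hu : u ∈ (extChartAt I x₀).target)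
    (hg : MDifferentiableAt I 𝓘(ℝ, EuclideanSpace ℝ (Fin D)) g ((extChartAt I x₀).symm u)) :
    HasFDerivWithinAt (fun w => g ((extChartAt I x₀).symm w))
      (ambientDeriv I g ((extChartAt I x₀).symm u) ∘L chartSymmDeriv I x₀ u) (range I) u := by
  have h := hg.hasMFDerivAt.comp_hasMFDerivWithinAt u
    (mdifferentiableWithinAt_extChartAt_symm hu).hasMFDerivWithinAt
  exact h.hasFDerivWithinAt

/-- `ambientDeriv` at `x` is written in the preferred chart at `x`, which may jump with `x`.
Composition with the derivative of one fixed inverse chart removes the jumps. In finite dimension,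
continuity may be tested on each vector `v`. -/
theorem continuousOn_ambientDeriv_chart [IsManifold I 1 X]
    {G : ℝ → X → EuclideanSpace ℝ (Fin D)}
    (hG : Continuous fun p : ℝ × TangentBundle I X => ambientDeriv I (G p.1) p.2.proj p.2.snd)
    (x₀ : X) :
    ContinuousOn (fun q : ℝ × EuclideanSpace ℝ (Fin d) =>
      ambientDeriv I (G q.1) ((extChartAt I x₀).symm q.2) ∘L chartSymmDeriv I x₀ q.2)
      (univ ×ˢ (extChartAt I x₀).target) := by
  rw [continuousOn_clm_apply]
  intro v
  have hun := (uniqueDiffOn_extChartAt_target (I := I) x₀).uniqueMDiffOn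
  have ht := (contMDiffOn_extChartAt_symm (I := I) (n := 1) x₀).continuousOn_tangentMapWithin le_rfl
    hun
  have hc : Continuous fun u : EuclideanSpace ℝ (Fin d) =>
      (⟨u, v⟩ : TangentBundle 𝓘(ℝ, EuclideanSpace ℝ (Fin d)) (EuclideanSpace ℝ (Fin d))) :=
    (tangentBundleModelSpaceHomeomorph 𝓘(ℝ, EuclideanSpace ℝ (Fin d))).symm.continuous.comp
      (Continuous.prodMk continuous_id continuous_const)
  have h1 : ContinuousOn (fun q : ℝ × EuclideanSpace ℝ (Fin d) => (q.1,
      tangentMapWithin 𝓘(ℝ, EuclideanSpace ℝ (Fin d)) I (extChartAt I x₀).symm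
        (extChartAt I x₀).target ⟨q.2, v⟩)) (univ ×ˢ (extChartAt I x₀).target) :=
    continuousOn_fst.prodMk (ht.comp (hc.comp continuous_snd).continuousOn fun q hq => hq.2)
  refine (hG.comp_continuousOn h1).congr fun q hq => ?_
  have e : mfderivWithin 𝓘(ℝ, EuclideanSpace ℝ (Fin d)) I (extChartAt I x₀).symm
      (extChartAt I x₀).target q.2 = chartSymmDeriv I x₀ q.2 :=
    (mdifferentiableWithinAt_extChartAt_symm hq.2).mfderivWithin_mono (hun _ hq.2)
      (extChartAt_target_subset_range x₀)
  simp only [Function.comp_apply, tangentMapWithin, e]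
  rfl

theorem continuousOn_ambientDeriv_val_chart [IsManifold I ∞ X] (hX : IsSubmanifold I X)
    (x₀ : X) :
    ContinuousOn (fun u : EuclideanSpace ℝ (Fin d) =>
      ambientDeriv I Subtype.val ((extChartAt I x₀).symm u) ∘L chartSymmDeriv I x₀ u)
      (extChartAt I x₀).target := by
  have h1 : ContDiffOn ℝ ∞ (fun w => (((extChartAt I x₀).symm w : X) : EuclideanSpace ℝ (Fin D)))
      (extChartAt I x₀).target :=
    (hX.contMDiff.comp_contMDiffOn (contMDiffOn_extChartAt_symm x₀)).contDiffOn
  refine (h1.continuousOn_fderivWithin (uniqueDiffOn_extChartAt_target x₀) (by simp)).congr ?_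
  intro u hu
  exact (((hasFDerivWithinAt_comp_extChartAt_symm x₀ hu
    (hX.contMDiff.mdifferentiableAt (by simp))).mono
      (extChartAt_target_subset_range x₀)).fderivWithin
      (uniqueDiffOn_extChartAt_target x₀ u hu)).symm

/-- A map on `X` with a derivative in the sense of Whitney is differentiable. -/
theorem ambientDeriv_eq_of_whitney [IsManifold I ∞ X] (hX : IsSubmanifold I X)
    {g : X → EuclideanSpace ℝ (Fin D)} {x : X}
    {V : EuclideanSpace ℝ (Fin D) →L[ℝ] EuclideanSpace ℝ (Fin D)}
    (hg : ∀ ε > 0, ∃ ρ > 0, ∀ x' : X, ‖(x' - x : EuclideanSpace ℝ (Fin D))‖ < ρ →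
      ‖g x' - g x - V (x' - x)‖ ≤ ε * ‖(x' - x : EuclideanSpace ℝ (Fin D))‖) :
    ambientDeriv I g x = V ∘L ambientDeriv I Subtype.val x := by
  have hι := (hX.contMDiff.mdifferentiableAt (x := x) (by simp)).hasMFDerivAt
  have hlit : (fun x' : X => g x' - g x - V (x' - x)) =o[𝓝 x]
      fun x' : X => (x' - x : EuclideanSpace ℝ (Fin D)) := by
    rw [Asymptotics.isLittleO_iff]
    intro ε hε
    obtain ⟨ρ, hρ, h⟩ := hg ε hε
    have : ∀ᶠ x' : X in 𝓝 x, ‖(x' - x : EuclideanSpace ℝ (Fin D))‖ < ρ := by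
      have hc : Continuous fun x' : X => ‖(x' - x : EuclideanSpace ℝ (Fin D))‖ := by fun_prop
      exact (hc.tendsto x).eventually (gt_mem_nhds (by simpa using hρ))
    exact this.mono h
  have hsub : Tendsto (fun x' : X => (x' - x : EuclideanSpace ℝ (Fin D))) (𝓝 x) (𝓝 0) := by
    have hc : Continuous fun x' : X => (x' - x : EuclideanSpace ℝ (Fin D)) := by fun_prop
    simpa using hc.tendsto x
  have hcont : ContinuousAt g x := by
    have h0 := hlit.trans_tendsto hsub
    have h1 := (h0.add ((V.continuous.tendsto 0).comp hsub)).const_add (g x)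
    simp only [Function.comp_apply, map_zero, add_zero] at h1
    refine h1.congr fun x' => ?_
    abel
  refine HasMFDerivAt.mfderiv ⟨hcont, ?_⟩
  have hι2 : HasFDerivWithinAt (fun w => (((extChartAt I x).symm w : X) : EuclideanSpace ℝ (Fin D)))
      (ambientDeriv I Subtype.val x) (range I) (extChartAt I x x) := hι.2
  have hsymm : Tendsto (extChartAt I x).symm (𝓝[range I] (extChartAt I x x)) (𝓝 x) := by
    have := (continuousAt_extChartAt_symm (I := I) x).continuousWithinAt (s := range I)
    rwa [ContinuousWithinAt, extChartAt_to_inv] at this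
  have hgoal : HasFDerivWithinAt (fun w => g ((extChartAt I x).symm w))
      (V ∘L ambientDeriv I Subtype.val x) (range I) (extChartAt I x x) := by
    have hO := hι2.isBigO_sub
    have h1 := (hlit.comp_tendsto hsymm).trans_isBigO
      (hO.congr_left fun w => by rw [Function.comp_apply, extChartAt_to_inv])
    have h2 := (V.hasFDerivAt.comp_hasFDerivWithinAt _ hι2).isLittleO
    refine .of_isLittleO ((h1.add h2).congr_left fun w => ?_)
    simp only [Function.comp_apply, extChartAt_to_inv, map_sub]
    abel
  exact hgoal

/-- The change of coordinates multiplies both Gram determinants by the same squared determinant,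
which cancels. -/
theorem absDet_eq_chart [IsManifold I 1 X] {ψ : X → X} {x₀ x : X}
    (hx : x ∈ (extChartAt I x₀).source)
    {V : EuclideanSpace ℝ (Fin D) →L[ℝ] EuclideanSpace ℝ (Fin D)}
    (hψ : ambientDeriv I (fun y => (ψ y : EuclideanSpace ℝ (Fin D))) x =
      V ∘L ambientDeriv I Subtype.val x) :
    absDet I ψ x = √((gramOp (V ∘L (ambientDeriv I Subtype.val x ∘L
        chartSymmDeriv I x₀ (extChartAt I x₀ x)))).det /
      (gramOp (ambientDeriv I Subtype.val x ∘L chartSymmDeriv I x₀ (extChartAt I x₀ x))).det) := by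
  have hdet : (chartSymmDeriv I x₀ (extChartAt I x₀ x)).det ≠ 0 :=
    det_ne_zero_of_isUnit (isUnit_chartSymmDeriv x₀ ((extChartAt I x₀).map_source hx))
  rw [absDet, gramDet_eq_det_gramOp, gramDet_eq_det_gramOp, hψ, ← ContinuousLinearMap.comp_assoc,
    det_gramOp_comp, det_gramOp_comp _ (chartSymmDeriv I x₀ (extChartAt I x₀ x)),
    mul_div_mul_left _ _ (pow_ne_zero 2 hdet)]

theorem continuousOn_absDet [IsManifold I ∞ X] (hX : IsSubmanifold I X) {ψ : ℝ → X → X} {s : Set ℝ}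
    {V : ℝ → X → EuclideanSpace ℝ (Fin D) →L[ℝ] EuclideanSpace ℝ (Fin D)}
    (hV : ContinuousOn (fun p : ℝ × X => V p.1 p.2) (s ×ˢ univ))
    (hψ : ∀ b ∈ s, ∀ x, ambientDeriv I (fun y => (ψ b y : EuclideanSpace ℝ (Fin D))) x =
      V b x ∘L ambientDeriv I Subtype.val x) :
    ContinuousOn (fun p : ℝ × X => absDet I (ψ p.1) p.2) (s ×ˢ univ) := by
  rintro ⟨b, x₀⟩ hb
  have : IsManifold I 1 X := inferInstance
  have hsrc : ∀ᶠ p : ℝ × X in 𝓝[s ×ˢ univ] (b, x₀), p.2 ∈ (extChartAt I x₀).source :=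
    (continuous_snd.continuousWithinAt (x := (b, x₀))).eventually (extChartAt_source_mem_nhds x₀)
  have hT : ContinuousWithinAt (fun p : ℝ × X => ambientDeriv I Subtype.val p.2 ∘L
      chartSymmDeriv I x₀ (extChartAt I x₀ p.2)) (s ×ˢ univ) (b, x₀) := by
    have h1 := (continuousOn_ambientDeriv_val_chart hX x₀).comp (continuousOn_extChartAt x₀)
      (extChartAt I x₀).mapsTo
    have h2 : ContinuousAt (fun x : X => ambientDeriv I Subtype.val x ∘L
        chartSymmDeriv I x₀ (extChartAt I x₀ x)) x₀ := by
      refine (h1.continuousAt (extChartAt_source_mem_nhds x₀)).congr ?_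
      filter_upwards [extChartAt_source_mem_nhds (I := I) x₀] with x hx
      simp only [Function.comp_apply, (extChartAt I x₀).left_inv hx]
    exact (h2.comp (f := fun p : ℝ × X => p.2) (x := (b, x₀))
      continuous_snd.continuousAt).continuousWithinAt
  have hu0 := isUnit_chartSymmDeriv (I := I) x₀ (mem_extChartAt_target x₀)
  have hne : (gramOp (ambientDeriv I Subtype.val x₀ ∘L
      chartSymmDeriv I x₀ (extChartAt I x₀ x₀))).det ≠ 0 := by
    have hinj : Function.Injective (ambientDeriv I Subtype.val x₀ ∘L
        chartSymmDeriv I x₀ (extChartAt I x₀ x₀)) :=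
      (hX.immersion x₀).comp (ContinuousLinearMap.isUnit_iff_bijective.1 hu0).1
    exact det_ne_zero_of_isUnit (isUnit_gramOp hinj)
  have hdet : Continuous fun T : EuclideanSpace ℝ (Fin d) →L[ℝ] EuclideanSpace ℝ (Fin D) =>
      (gramOp T).det := ContinuousLinearMap.continuous_det.comp continuous_gramOp
  have hmain := ((hdet.continuousAt.comp_continuousWithinAt ((hV _ hb).clm_comp hT)).div
    (hdet.continuousAt.comp_continuousWithinAt hT) hne).sqrt
  refine hmain.congr_of_eventuallyEq ?_ (absDet_eq_chart (mem_extChartAt_source x₀) (hψ b hb.1 x₀))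
  filter_upwards [hsrc, self_mem_nhdsWithin] with p hp hps
  exact absDet_eq_chart hp (hψ p.1 hps.1 p.2)

end Chart

/-! ### Whitney differentiability of `C¹` fields on the submanifold -/

/-- Uniform strict differentiability within a convex set of a family of maps whose derivative is
jointly continuous. -/
theorem eventually_norm_sub_sub_le_of_convex {E E' : Type*} [NormedAddCommGroup E]
    [NormedSpace ℝ E] [NormedAddCommGroup E'] [NormedSpace ℝ E'] {R s : Set E} (hR : Convex ℝ R)
    {g : ℝ → E → E'} {g' : ℝ → E → E →L[ℝ] E'} {t₀ : ℝ} {u₀ : E} (hs : s ∈ 𝓝[R] u₀) (hu₀ : u₀ ∈ s)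
    (hsR : s ⊆ R) (hg : ∀ t, ∀ u ∈ s, HasFDerivWithinAt (g t) (g' t u) R u)
    (hg' : ContinuousOn (fun q : ℝ × E => g' q.1 q.2) (univ ×ˢ s)) {ε : ℝ} (hε : 0 < ε) :
    ∀ᶠ q : ℝ × E × E in 𝓝 t₀ ×ˢ (𝓝[R] u₀ ×ˢ 𝓝[R] u₀),
      ‖g q.1 q.2.2 - g q.1 q.2.1 - g' t₀ u₀ (q.2.2 - q.2.1)‖ ≤ ε * ‖q.2.2 - q.2.1‖ := by
  have h1 : ∀ᶠ q : ℝ × E in 𝓝 t₀ ×ˢ 𝓝[R] u₀, ‖g' q.1 q.2 - g' t₀ u₀‖ < ε ∧ q.2 ∈ s := by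
    have h2 : 𝓝[univ ×ˢ s] (t₀, u₀) = 𝓝 t₀ ×ˢ 𝓝[R] u₀ := by
      rw [nhdsWithin_prod_eq, nhdsWithin_univ,
        le_antisymm (nhdsWithin_mono u₀ hsR) (nhdsWithin_le_of_mem hs)]
    have h3 := hg' (t₀, u₀) ⟨mem_univ _, hu₀⟩
    rw [ContinuousWithinAt, h2] at h3
    have h4 := h3.eventually (Metric.ball_mem_nhds _ hε)
    filter_upwards [h4, tendsto_snd.eventually hs] with q hq hqs
    exact ⟨by simpa [dist_eq_norm] using hq, hqs⟩
  obtain ⟨T, hT, W, hW, hTW⟩ := eventually_prod_iff.1 h1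
  obtain ⟨r, hr, hrW⟩ := Metric.mem_nhdsWithin_iff.1 hW
  have hB : Metric.ball u₀ r ∩ R ∈ 𝓝[R] u₀ :=
    inter_mem (mem_nhdsWithin_of_mem_nhds (Metric.ball_mem_nhds _ hr)) self_mem_nhdsWithin
  filter_upwards [prod_mem_prod (s := Set.ofPred T) hT (prod_mem_prod hB hB)] with ⟨t, u, u'⟩ hq
  obtain ⟨ht, hu, hu'⟩ : T t ∧ u ∈ Metric.ball u₀ r ∩ R ∧ u' ∈ Metric.ball u₀ r ∩ R := hq
  have hb : ∀ w ∈ Metric.ball u₀ r ∩ R, ‖g' t w - g' t₀ u₀‖ < ε ∧ w ∈ s := fun w hw =>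
    hTW ht (hrW hw)
  -- The mean value inequality on the convex set `ball ∩ R`, where the derivative stays within `ε`
  -- of its value at the centre.
  exact Convex.norm_image_sub_le_of_norm_hasFDerivWithin_le' (𝕜 := ℝ) (f := g t) (f' := g' t)
    (φ := g' t₀ u₀) (s := Metric.ball u₀ r ∩ R)
    (fun w hw => (hg t w (hb w hw).2).mono inter_subset_right) (fun w hw => (hb w hw).1.le)
    ((convex_ball u₀ r).inter hR) hu hu'

section Whitney

variable {d D : ℕ} {H : Type*} [TopologicalSpace H]
  {I : ModelWithCorners ℝ (EuclideanSpace ℝ (Fin d)) H}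
  {X : Set (EuclideanSpace ℝ (Fin D))} [ChartedSpace H X]

variable (I) in
/-- The linear map on `ℝ^D` which extends the derivative of `g` at `x` by zero on the normal
space. -/
noncomputable def whitneyDeriv (g : X → EuclideanSpace ℝ (Fin D)) (x : X) :
    EuclideanSpace ℝ (Fin D) →L[ℝ] EuclideanSpace ℝ (Fin D) :=
  ambientDeriv I g x ∘L leftInv (ambientDeriv I Subtype.val x)

theorem whitneyDeriv_eq_chart [IsManifold I 1 X] (hX : IsSubmanifold I X)
    (g : X → EuclideanSpace ℝ (Fin D)) {x₀ x : X} (hx : x ∈ (extChartAt I x₀).source) :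
    whitneyDeriv I g x = (ambientDeriv I g x ∘L chartSymmDeriv I x₀ (extChartAt I x₀ x)) ∘L
      leftInv (ambientDeriv I Subtype.val x ∘L chartSymmDeriv I x₀ (extChartAt I x₀ x)) := by
  rw [ContinuousLinearMap.comp_assoc, comp_leftInv_comp (hX.immersion x)
    (isUnit_chartSymmDeriv x₀ ((extChartAt I x₀).map_source hx))]
  rfl

theorem injective_chart [IsManifold I 1 X] (hX : IsSubmanifold I X) (x₀ : X) :
    Function.Injective (ambientDeriv I Subtype.val x₀ ∘L
      chartSymmDeriv I x₀ (extChartAt I x₀ x₀)) :=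
  (hX.immersion x₀).comp (ContinuousLinearMap.isUnit_iff_bijective.1
    (isUnit_chartSymmDeriv (I := I) x₀ (mem_extChartAt_target x₀))).1

variable [IsManifold I ∞ X] {G : ℝ → X → EuclideanSpace ℝ (Fin D)}

theorem continuous_whitneyDeriv (hX : IsSubmanifold I X)
    (hG : Continuous fun p : ℝ × TangentBundle I X => ambientDeriv I (G p.1) p.2.proj p.2.snd) :
    Continuous fun p : ℝ × X => whitneyDeriv I (G p.1) p.2 := by
  rw [continuous_iff_continuousAt]
  rintro ⟨t₀, x₀⟩
  have hsrc : univ ×ˢ (extChartAt I x₀).source ∈ 𝓝 ((t₀, x₀) : ℝ × X) :=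
    prod_mem_nhds univ_mem (extChartAt_source_mem_nhds x₀)
  have hT : ContinuousAt (fun p : ℝ × X => ambientDeriv I Subtype.val p.2 ∘L
      chartSymmDeriv I x₀ (extChartAt I x₀ p.2)) (t₀, x₀) := by
    have h1 := ((continuousOn_ambientDeriv_val_chart hX x₀).comp (continuousOn_extChartAt x₀)
      (extChartAt I x₀).mapsTo).comp (s := univ ×ˢ (extChartAt I x₀).source)
      (f := fun p : ℝ × X => p.2) continuousOn_snd fun p hp => hp.2
    refine (h1.continuousAt hsrc).congr ?_
    filter_upwards [hsrc] with p hp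
    simp only [Function.comp_apply, (extChartAt I x₀).left_inv hp.2]
  have hS : ContinuousAt (fun p : ℝ × X => ambientDeriv I (G p.1) p.2 ∘L
      chartSymmDeriv I x₀ (extChartAt I x₀ p.2)) (t₀, x₀) := by
    have h1 := (continuousOn_ambientDeriv_chart hG x₀).comp
      (s := univ ×ˢ (extChartAt I x₀).source)
      (f := fun p : ℝ × X => (p.1, extChartAt I x₀ p.2))
      (continuousOn_fst.prodMk ((continuousOn_extChartAt x₀).comp continuousOn_snd
        fun p hp => hp.2)) fun p hp => ⟨mem_univ _, (extChartAt I x₀).map_source hp.2⟩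
    refine (h1.continuousAt hsrc).congr ?_
    filter_upwards [hsrc] with p hp
    simp only [Function.comp_apply, (extChartAt I x₀).left_inv hp.2]
  have hL := ContinuousAt.comp (x := ((t₀, x₀) : ℝ × X))
    (continuousAt_leftInv (injective_chart hX x₀)) hT
  refine (hS.clm_comp hL).congr ?_
  filter_upwards [hsrc] with p hp
  exact (whitneyDeriv_eq_chart hX _ hp.2).symm

/-- In a chart, `G t` and the inclusion are both strictly differentiable, uniformly in `t`. Since
the derivative `T₀` of the inclusion is bounded below, chart increments `Δ` are controlled by
ambient increments `δ`, and the estimate passes from the chart to `ℝ^D`. -/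
theorem eventually_whitney (hX : IsSubmanifold I X)
    (hC1 : ∀ t, ContMDiff I 𝓘(ℝ, EuclideanSpace ℝ (Fin D)) 1 (G t))
    (hG : Continuous fun p : ℝ × TangentBundle I X => ambientDeriv I (G p.1) p.2.proj p.2.snd)
    (t₀ : ℝ) (x₀ : X) {ε : ℝ} (hε : 0 < ε) :
    ∀ᶠ q : ℝ × X × X in 𝓝 (t₀, x₀, x₀),
      ‖G q.1 q.2.2 - G q.1 q.2.1 - whitneyDeriv I (G q.1) q.2.1 (q.2.2 - q.2.1)‖ ≤
        ε * ‖(q.2.2 - q.2.1 : EuclideanSpace ℝ (Fin D))‖ := by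
  set e := extChartAt I x₀ with he
  set u₀ := e x₀ with hu₀
  have hu₀t : u₀ ∈ e.target := mem_extChartAt_target x₀
  have hsymm : e.symm u₀ = x₀ := extChartAt_to_inv x₀
  set T₀ := ambientDeriv I Subtype.val x₀ ∘L chartSymmDeriv I x₀ u₀ with hT₀
  have hinj : Function.Injective T₀ := injective_chart hX x₀
  set A₀ := whitneyDeriv I (G t₀) x₀ with hA₀
  have hAT : ambientDeriv I (G t₀) x₀ ∘L chartSymmDeriv I x₀ u₀ = A₀ ∘L T₀ := by
    rw [hA₀, whitneyDeriv_eq_chart hX _ (mem_extChartAt_source x₀),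
      ContinuousLinearMap.comp_assoc, leftInv_comp hinj, ContinuousLinearMap.comp_id]
  obtain ⟨K, hK, hanti⟩ := LinearMap.exists_antilipschitzWith
    (T₀ : EuclideanSpace ℝ (Fin d) →ₗ[ℝ] EuclideanSpace ℝ (Fin D)) (LinearMap.ker_eq_bot.2 hinj)
  have hK0 : (0 : ℝ) < K := hK
  have hlow : ∀ v, ‖v‖ ≤ K * ‖T₀ v‖ := fun v => by
    have := hanti.le_mul_dist v 0
    simpa using this
  -- The first bound absorbs `K * η * ‖Δ‖` to give `‖Δ‖ ≤ 2 * K * ‖δ‖`. The second keeps both chart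
  -- errors below `ε / 2 * ‖δ‖`; the other half of `ε` pays for replacing `A₀` by the derivative at
  -- `y`.
  set η : ℝ := min (1 / (2 * K)) (ε / (4 * K * (1 + ‖A₀‖))) with hη
  have hA1 : 0 < 1 + ‖A₀‖ := by positivity
  have hηpos : 0 < η := by positivity
  have hη1 : K * η ≤ 1 / 2 := by
    calc K * η ≤ K * (1 / (2 * K)) := by gcongr; exact min_le_left _ _
      _ = 1 / 2 := by field_simp
  have hη2 : η * (1 + ‖A₀‖) * (2 * K) ≤ ε / 2 := by
    calc η * (1 + ‖A₀‖) * (2 * K) ≤ ε / (4 * K * (1 + ‖A₀‖)) * (1 + ‖A₀‖) * (2 * K) := by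
          gcongr; exact min_le_right _ _
      _ = ε / 2 := by field_simp; norm_num
  have htend : Tendsto (fun q : ℝ × X × X => (q.1, e q.2.1, e q.2.2)) (𝓝 (t₀, x₀, x₀))
      (𝓝 t₀ ×ˢ (𝓝[range I] u₀ ×ˢ 𝓝[range I] u₀)) := by
    have h1 : Tendsto e (𝓝 x₀) (𝓝[range I] u₀) :=
      tendsto_nhdsWithin_of_tendsto_nhds_of_eventually_within _ (continuousAt_extChartAt x₀)
        (.of_forall fun x => ⟨chartAt H x₀ x, rfl⟩)
    exact (continuous_fst.tendsto' _ _ rfl).prodMk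
      ((h1.comp (continuous_snd.fst.tendsto' _ _ rfl)).prodMk
        (h1.comp (continuous_snd.snd.tendsto' _ _ rfl)))
  have h1 := htend.eventually (eventually_norm_sub_sub_le_of_convex I.convex_range
    (g := fun t u => G t (e.symm u)) (t₀ := t₀) (extChartAt_target_mem_nhdsWithin x₀) hu₀t
    (extChartAt_target_subset_range x₀) (fun t u hu => hasFDerivWithinAt_comp_extChartAt_symm x₀ hu
      ((hC1 t).mdifferentiableAt (by simp))) (continuousOn_ambientDeriv_chart hG x₀) hηpos)
  have h2 := htend.eventually (eventually_norm_sub_sub_le_of_convex I.convex_range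
    (g := fun _ u => ((e.symm u : X) : EuclideanSpace ℝ (Fin D))) (t₀ := t₀)
    (extChartAt_target_mem_nhdsWithin x₀) hu₀t
    (extChartAt_target_subset_range x₀) (fun t u hu => hasFDerivWithinAt_comp_extChartAt_symm x₀ hu
      (hX.contMDiff.mdifferentiableAt (by simp)))
      ((continuousOn_ambientDeriv_val_chart hX x₀).comp continuousOn_snd fun q hq => hq.2) hηpos)
  have h3 : ∀ᶠ q : ℝ × X × X in 𝓝 (t₀, x₀, x₀), ‖whitneyDeriv I (G q.1) q.2.1 - A₀‖ < ε / 2 := by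
    have hc : Continuous fun q : ℝ × X × X => whitneyDeriv I (G q.1) q.2.1 :=
      (continuous_whitneyDeriv hX hG).comp (continuous_fst.prodMk continuous_snd.fst)
    have := (hc.tendsto (t₀, x₀, x₀)).eventually (Metric.ball_mem_nhds _ (half_pos hε))
    simpa [dist_eq_norm] using this
  have h4 : ∀ᶠ q : ℝ × X × X in 𝓝 (t₀, x₀, x₀), q.2.1 ∈ e.source ∧ q.2.2 ∈ e.source :=
    ((continuous_snd.fst.tendsto (t₀, x₀, x₀)).eventually (extChartAt_source_mem_nhds x₀)).and
      ((continuous_snd.snd.tendsto (t₀, x₀, x₀)).eventually (extChartAt_source_mem_nhds x₀))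
  filter_upwards [h1, h2, h3, h4] with ⟨t, y, y'⟩ b1 b2 b3 b4
  simp only [extChartAt_to_inv, e.left_inv b4.1, e.left_inv b4.2] at b1 b2 b3 ⊢
  change ‖_ - (ambientDeriv I (G t₀) x₀ ∘L chartSymmDeriv I x₀ u₀) _‖ ≤ _ at b1
  rw [hAT] at b1
  change ‖_ - T₀ _‖ ≤ _ at b2
  set Δ := e y' - e y with hΔ
  set δ : EuclideanSpace ℝ (Fin D) := y' - y with hδ
  have c1 : ‖Δ‖ ≤ 2 * K * ‖δ‖ := by
    have a1 : ‖T₀ Δ‖ ≤ ‖δ‖ + η * ‖Δ‖ := by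
      have : T₀ Δ = δ - (δ - T₀ Δ) := by abel
      rw [this]
      exact (norm_sub_le _ _).trans (add_le_add_right b2 _)
    have a2 : ‖Δ‖ ≤ K * ‖δ‖ + K * η * ‖Δ‖ := by
      refine (hlow Δ).trans ?_
      have := mul_le_mul_of_nonneg_left a1 hK0.le
      linarith
    have a3 := mul_le_mul_of_nonneg_right hη1 (norm_nonneg Δ)
    linarith
  have eq1 : G t y' - G t y - whitneyDeriv I (G t) y δ =
      (G t y' - G t y - (A₀ ∘L T₀) Δ) - A₀ (δ - T₀ Δ) - (whitneyDeriv I (G t) y - A₀) δ := by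
    simp only [ContinuousLinearMap.comp_apply, map_sub, sub_apply]
    abel
  have n1 : ‖A₀ (δ - T₀ Δ)‖ ≤ ‖A₀‖ * (η * ‖Δ‖) :=
    (A₀.le_opNorm _).trans (mul_le_mul_of_nonneg_left b2 (norm_nonneg _))
  have n2 : ‖(whitneyDeriv I (G t) y - A₀) δ‖ ≤ ε / 2 * ‖δ‖ :=
    ContinuousLinearMap.le_of_opNorm_le _ b3.le δ
  rw [eq1]
  have n3 := norm_sub_le ((G t y' - G t y - (A₀ ∘L T₀) Δ) - A₀ (δ - T₀ Δ))
    ((whitneyDeriv I (G t) y - A₀) δ)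
  have n4 := norm_sub_le (G t y' - G t y - (A₀ ∘L T₀) Δ) (A₀ (δ - T₀ Δ))
  have n5 : η * (1 + ‖A₀‖) * ‖Δ‖ ≤ ε / 2 * ‖δ‖ := by
    calc η * (1 + ‖A₀‖) * ‖Δ‖ ≤ η * (1 + ‖A₀‖) * (2 * K * ‖δ‖) := by gcongr
      _ = η * (1 + ‖A₀‖) * (2 * K) * ‖δ‖ := by ring
      _ ≤ _ := by gcongr
  linarith

theorem exists_whitney [CompactSpace X] (hX : IsSubmanifold I X)
    (hC1 : ∀ t, ContMDiff I 𝓘(ℝ, EuclideanSpace ℝ (Fin D)) 1 (G t))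
    (hG : Continuous fun p : ℝ × TangentBundle I X => ambientDeriv I (G p.1) p.2.proj p.2.snd)
    (Q : ℝ) {ε : ℝ} (hε : 0 < ε) :
    ∃ ρ > 0, ∀ t, |t| ≤ Q → ∀ y y' : X, ‖(y' - y : EuclideanSpace ℝ (Fin D))‖ < ρ →
      ‖G t y' - G t y - whitneyDeriv I (G t) y (y' - y)‖ ≤
        ε * ‖(y' - y : EuclideanSpace ℝ (Fin D))‖ := by
  have h1 : ∀ᶠ p : X × X in uniformity X, ∀ t ∈ Icc (-Q) Q,
      ‖G t p.2 - G t p.1 - whitneyDeriv I (G t) p.1 (p.2 - p.1)‖ ≤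
        ε * ‖(p.2 - p.1 : EuclideanSpace ℝ (Fin D))‖ := by
    -- On a compact space the entourages are the neighbourhoods of the diagonal, so the local
    -- estimate becomes uniform; compactness of `[-Q, Q]` handles `t`.
    rw [← nhdsSet_diagonal_eq_uniformity]
    refine mem_nhdsSet_iff_forall.2 ?_
    rintro ⟨x, x'⟩ hxx
    obtain rfl : x = x' := hxx
    refine isCompact_Icc.eventually_forall_of_forall_eventually fun t _ => ?_
    exact (continuous_swap.tendsto ((x, x), t)).eventually (eventually_whitney hX hC1 hG t x hε)
  obtain ⟨ρ, hρ, h⟩ := Metric.mem_uniformity_dist.1 h1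
  refine ⟨ρ, hρ, fun t ht y y' hy => h (a := y) (b := y') ?_ t (abs_le.1 ht)⟩
  rwa [dist_comm, Subtype.dist_eq, dist_eq_norm]

end Whitney

/-! ### Normalised volume and transfer integrals -/

/-- `a⁻¹ * a ≤ 1` holds for every `a` in `ℝ≥0∞`, so the total Hausdorff mass need not be shown
finite or nonzero. -/
instance isFiniteMeasure_normVolume (d : ℕ) {D : ℕ} (X : Set (EuclideanSpace ℝ (Fin D))) :
    IsFiniteMeasure (normVolume d X) :=
  ⟨by
    rw [normVolume, Measure.smul_apply, smul_eq_mul]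
    exact (ENNReal.inv_mul_le_one _).trans_lt ENNReal.one_lt_top⟩

/-- The preimage is the image under the Lipschitz inverse, and Hausdorff measure scales accordingly;
no change of variables formula is involved. -/
theorem normVolume_preimage_le (d : ℕ) {D : ℕ} {X : Set (EuclideanSpace ℝ (Fin D))} {ψ χ : X → X}
    (h₁ : Function.LeftInverse χ ψ) (h₂ : Function.RightInverse χ ψ) {K : NNReal}
    (hχ : LipschitzWith K χ) (A : Set X) :
    normVolume d X (ψ ⁻¹' A) ≤ K ^ d * normVolume d X A := by
  rw [← image_eq_preimage_of_inverse h₂ h₁, normVolume, Measure.smul_apply, Measure.smul_apply,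
    smul_eq_mul, smul_eq_mul, mul_left_comm]
  gcongr
  have := hχ.hausdorffMeasure_image_le (d := d) (Nat.cast_nonneg d) A
  rwa [ENNReal.rpow_natCast] at this

/-- Continuity of transfer integrals under uniformly nonsingular continuous maps. -/
theorem continuousAt_setIntegral_comp_mul {X : Type*} [MetricSpace X] [CompactSpace X]
    [MeasurableSpace X] [BorelSpace X] {m : Measure X} [IsFiniteMeasure m] {ψ : ℝ → X → X}
    {J : ℝ → X → ℝ} (hψ : Continuous fun p : ℝ × X => ψ p.1 p.2)
    (hJ : Continuous fun p : ℝ × X => J p.1 p.2) {b₀ : ℝ} {C : ℝ≥0∞} (hC : C ≠ ⊤)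
    (hm : ∀ᶠ b in 𝓝 b₀, ∀ A, MeasurableSet A → m (ψ b ⁻¹' A) ≤ C * m A)
    {h : X → ℝ} (hh : Measurable h) {c : ℝ} (hc : ∀ x, ‖h x‖ ≤ c) (S : Set X) :
    ContinuousAt (fun b => ∫ x in S, h (ψ b x) * J b x ∂m) b₀ := by
  obtain ⟨CJ, hCJ⟩ := ((isCompact_Icc (a := b₀ - 1) (b := b₀ + 1)).prod
    (isCompact_univ (X := X))).exists_bound_of_continuousOn hJ.continuousOn
  have hnear : ∀ᶠ b in 𝓝 b₀, b ∈ Icc (b₀ - 1) (b₀ + 1) :=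
    Icc_mem_nhds (by linarith) (by linarith)
  have hψb : ∀ b, Continuous (ψ b) := fun b => hψ.comp (by fun_prop : Continuous fun x => (b, x))
  have hJb : ∀ b, Continuous (J b) := fun b => hJ.comp (by fun_prop : Continuous fun x => (b, x))
  have hint : Integrable h m :=
    Integrable.of_bound hh.aestronglyMeasurable c (.of_forall hc)
  have hintJ : ∀ {k : X → ℝ} {c : ℝ}, Measurable k → (∀ x, ‖k x‖ ≤ c) →
      ∀ b ∈ Icc (b₀ - 1) (b₀ + 1), Integrable (fun x => k (ψ b x) * J b x) (m.restrict S) := by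
    intro k c hk hkc b hb
    refine Integrable.of_bound
      ((hk.comp (hψb b).measurable).mul (hJb b).measurable).aestronglyMeasurable (c * CJ)
      (.of_forall fun x => ?_)
    rw [norm_mul]
    exact mul_le_mul (hkc _) (hCJ (b, x) ⟨hb, mem_univ _⟩) (norm_nonneg _)
      ((norm_nonneg _).trans (hkc x))
  -- Replacing `h` by a bounded continuous `g` costs at most `C * CJ * ‖h - g‖₁`, uniformly for `b`
  -- near `b₀`.
  refine continuousAt_of_locally_uniform_approx_of_continuousAt fun u hu => ?_
  obtain ⟨ε, hε, hεu⟩ := mem_uniformity_edist.1 hu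
  have hfin : C * ENNReal.ofReal CJ + 1 ≠ ⊤ := by
    exact ENNReal.add_ne_top.2 ⟨ENNReal.mul_ne_top hC ENNReal.ofReal_ne_top, ENNReal.one_ne_top⟩
  obtain ⟨ε', hε', hεε⟩ : ∃ ε' : ℝ≥0∞, ε' ≠ 0 ∧ C * ENNReal.ofReal CJ * ε' < ε := by
    rcases eq_or_ne ε ⊤ with rfl | hε0
    · exact ⟨1, one_ne_zero, by
        rw [mul_one]; exact (ENNReal.mul_ne_top hC ENNReal.ofReal_ne_top).lt_top⟩
    · refine ⟨ε / 2 / (C * ENNReal.ofReal CJ + 1),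
        (ENNReal.div_pos (ENNReal.half_pos hε.ne').ne' hfin).ne', ?_⟩
      calc C * ENNReal.ofReal CJ * (ε / 2 / (C * ENNReal.ofReal CJ + 1))
          ≤ (C * ENNReal.ofReal CJ + 1) * (ε / 2 / (C * ENNReal.ofReal CJ + 1)) := by
            gcongr; exact le_self_add
        _ ≤ ε / 2 := ENNReal.mul_div_le
        _ < ε := ENNReal.half_lt_self hε.ne' hε0
  obtain ⟨g, hg, -⟩ := hint.exists_boundedContinuous_lintegral_sub_le hε'
  refine ⟨{b | b ∈ Icc (b₀ - 1) (b₀ + 1) ∧ ∀ A, MeasurableSet A → m (ψ b ⁻¹' A) ≤ C * m A},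
    hnear.and hm, fun b => ∫ x in S, g (ψ b x) * J b x ∂m, ?_, fun b hb => hεu ?_⟩
  · have := continuous_parametric_integral_of_continuous (μ := m.restrict S)
      (f := fun b x => g (ψ b x) * J b x) (by
        exact (g.continuous.comp hψ).mul hJ) isCompact_univ
    simp only [Measure.restrict_univ] at this
    exact this.continuousAt
  · obtain ⟨hb, hmb⟩ := hb
    have hmap : m.map (ψ b) ≤ C • m := Measure.le_iff.2 fun A hA => by
      rw [Measure.map_apply (hψb b).measurable hA]
      exact hmb A hA
    rw [edist_eq_enorm_sub, ← integral_sub (hintJ hh hc b hb)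
      (hintJ g.continuous.measurable g.norm_coe_le_norm b hb)]
    refine lt_of_le_of_lt ?_ hεε
    calc ‖∫ x in S, (h (ψ b x) * J b x - g (ψ b x) * J b x) ∂m‖ₑ
        ≤ ∫⁻ x in S, ‖h (ψ b x) * J b x - g (ψ b x) * J b x‖ₑ ∂m :=
          enorm_integral_le_lintegral_enorm _
      _ ≤ ∫⁻ x in S, ENNReal.ofReal CJ * ‖h (ψ b x) - g (ψ b x)‖ₑ ∂m := by
          refine lintegral_mono fun x => ?_
          rw [← sub_mul, enorm_mul, mul_comm]
          gcongr
          rw [← ofReal_norm]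
          exact ENNReal.ofReal_le_ofReal (hCJ (b, x) ⟨hb, mem_univ _⟩)
      _ ≤ ∫⁻ x, ENNReal.ofReal CJ * ‖h (ψ b x) - g (ψ b x)‖ₑ ∂m := setLIntegral_le_lintegral _ _
      _ = ∫⁻ y, ENNReal.ofReal CJ * ‖h y - g y‖ₑ ∂(m.map (ψ b)) :=
          (lintegral_map (((hh.sub g.continuous.measurable).enorm).const_mul _)
            (hψb b).measurable).symm
      _ ≤ ∫⁻ y, ENNReal.ofReal CJ * ‖h y - g y‖ₑ ∂(C • m) := lintegral_mono' hmap le_rfl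
      _ = C * ENNReal.ofReal CJ * ∫⁻ y, ‖h y - g y‖ₑ ∂m := by
          rw [lintegral_smul_measure, lintegral_const_mul' _ _ ENNReal.ofReal_ne_top,
            smul_eq_mul, mul_assoc]
      _ ≤ _ := by gcongr

/-! ### Continuity of the Ulam matrices along a driving orbit -/

section Flow

variable {d D n : ℕ} {H : Type*} [TopologicalSpace H]
  {I : ModelWithCorners ℝ (EuclideanSpace ℝ (Fin d)) H}
  {X : Set (EuclideanSpace ℝ (Fin D))} [ChartedSpace H X] [IsManifold I ∞ X]
  {Ξ : Type*} {ξ : ℝ → Ξ → Ξ} {F : Ξ → X → EuclideanSpace ℝ (Fin D)} {φ : ℝ → Ξ → X → X}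
  {B : Fin n → Set X}

/-- On a single driving orbit the generalised time `ξ b z` is replaced by the real base time `b`;
shifting `z` along the orbit becomes varying `b`. -/
theorem IsFlowOf.whitneyFlow [CompactSpace X] (hX : IsSubmanifold I X) (hξ : IsDrivingFlow ξ)
    (hF : IsRegularField I ξ F) (hφ : IsFlowOf ξ F φ) (z : Ξ) :
    WhitneyFlow (fun t => F (ξ t z)) (fun t => whitneyDeriv I (F (ξ t z)))
      (fun s b => φ s (ξ b z)) where
  continuous := hF.continuous z
  continuous_deriv := continuous_whitneyDeriv (G := fun t => F (ξ t z)) hX (hF.continuous_deriv z)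
  whitney Q _ hε := exists_whitney (G := fun t => F (ξ t z)) hX
    (fun _ => hF.contMDiff _) (hF.continuous_deriv z) Q hε
  zero _ _ := hφ.zero _ _
  hasDerivAt s b x := by
    rw [hξ.add]
    exact hφ.hasDerivAt s (ξ b z) x

theorem continuous_absDet_flow [CompactSpace X] (hX : IsSubmanifold I X) (hξ : IsDrivingFlow ξ)
    (hF : IsRegularField I ξ F) (hφ : IsFlowOf ξ F φ) (z : Ξ) (s : ℝ) :
    Continuous fun p : ℝ × X => absDet I (φ s (ξ p.1 z)) p.2 := by
  rw [continuous_iff_continuousAt]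
  rintro ⟨b₀, x₀⟩
  obtain ⟨V, hV, hder⟩ := (hφ.whitneyFlow hX hξ hF z).exists_whitney_deriv s (|b₀| + 1)
  have hcont := continuousOn_absDet hX (ψ := fun b => φ s (ξ b z)) hV fun b hb x =>
    ambientDeriv_eq_of_whitney hX fun ε hε => by
      obtain ⟨ρ, hρ, h⟩ := hder b (abs_le.2 hb) ε hε
      exact ⟨ρ, hρ, h x⟩
  refine hcont.continuousAt (prod_mem_nhds (Icc_mem_nhds ?_ ?_) univ_mem)
  · linarith [neg_abs_le b₀]
  · linarith [le_abs_self b₀]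

theorem eventually_normVolume_preimage_flow_le [CompactSpace X] (hX : IsSubmanifold I X)
    (hξ : IsDrivingFlow ξ) (hF : IsRegularField I ξ F) (hφ : IsFlowOf ξ F φ) (z : Ξ) (s b₀ : ℝ) :
    ∃ C : ℝ≥0∞, C ≠ ⊤ ∧ ∀ᶠ b in 𝓝 b₀, ∀ A,
      normVolume d X (φ s (ξ b z) ⁻¹' A) ≤ C * normVolume d X A := by
  have hw := hφ.whitneyFlow hX hξ hF z
  -- The inverse of the flow map is the flow over time `-s` from base time `s + b`, which explains
  -- the radius.
  obtain ⟨L, hL, hl⟩ := hw.exists_lipschitz |s| (|s| + (|b₀| + 1))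
  refine ⟨(L.toNNReal : ℝ≥0∞) ^ d, ENNReal.pow_ne_top ENNReal.coe_ne_top, ?_⟩
  have hnear : ∀ᶠ b in 𝓝 b₀, |b| < |b₀| + 1 :=
    (continuous_abs.tendsto b₀).eventually (gt_mem_nhds (lt_add_one _))
  filter_upwards [hnear] with b hb A
  refine normVolume_preimage_le d (hw.leftInverse s b) (hw.rightInverse s b)
    (LipschitzWith.of_dist_le_mul fun x x' => ?_) A
  rw [Subtype.dist_eq, Subtype.dist_eq, dist_eq_norm, dist_eq_norm, Real.coe_toNNReal _ hL.le]
  exact hl (-s) (s + b) (abs_neg s).le ((abs_add_le _ _).trans (by gcongr)) x' x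

theorem continuous_ulamMatrix [CompactSpace X] (hX : IsSubmanifold I X) (hξ : IsDrivingFlow ξ)
    (hF : IsRegularField I ξ F) (hφ : IsFlowOf ξ F φ) (hB : ∀ i, MeasurableSet (B i)) (z : Ξ)
    (t : ℝ) : Continuous fun b => ulamMatrix I ξ φ B (ξ b z) t := by
  have key : ∀ i j, Continuous fun b => ∫ x in B i, (B j).indicator (fun _ => (1 : ℝ))
      (φ (-t) (ξ b z) x) * absDet I (φ (-t) (ξ b z)) x ∂(normVolume d X) := by
    intro i j
    rw [continuous_iff_continuousAt]
    intro b₀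
    obtain ⟨C, hC, hm⟩ := eventually_normVolume_preimage_flow_le hX hξ hF hφ z (-t) b₀
    exact continuousAt_setIntegral_comp_mul (ψ := fun b => φ (-t) (ξ b z))
      (J := fun b => absDet I (φ (-t) (ξ b z)))
      ((hφ.whitneyFlow hX hξ hF z).continuous_flow.comp
        (continuous_const.prodMk continuous_id))
      (continuous_absDet_flow hX hξ hF hφ z (-t)) hC (hm.mono fun b hb A _ => hb A)
      (measurable_const.indicator (hB j)) (c := 1)
      (fun x => (norm_indicator_le_norm_self _ _).trans (by simp)) (B i)
  refine continuous_pi fun i => continuous_pi fun j => ?_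
  -- The operator over time `t` from `ξ b z` pulls back from the final time `ξ (t + b) z`, hence the
  -- shift by `t`.
  have := ((key i j).comp (continuous_const_add t)).div_const ((normVolume d X).real (B i))
  refine this.congr fun b => ?_
  simp only [Function.comp_apply, ulamMatrix, perronFrobenius, Matrix.of_apply, hξ.add]

open scoped Matrix in
/-- The matrix `P^(t)(z)` represents `π_n P_z^(t)` on step functions. -/
theorem galerkin_perronFrobenius_stepFun [CompactSpace X] (hX : IsSubmanifold I X)
    (hξ : IsDrivingFlow ξ) (hF : IsRegularField I ξ F) (hφ : IsFlowOf ξ F φ)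
    (hB : ∀ i, MeasurableSet (B i)) (z : Ξ) (t : ℝ) (u : Fin n → ℝ) :
    galerkin (normVolume d X) B (perronFrobenius I ξ φ z t (stepFun B u)) =
      stepFun B (ulamMatrix I ξ φ B z t *ᵥ u) := by
  have hJ : Continuous fun x => absDet I (φ (-t) (ξ t z)) x := by
    have h := (continuous_absDet_flow hX hξ hF hφ (ξ t z) (-t)).comp
      (f := fun x : X => ((0 : ℝ), x)) (by fun_prop)
    simpa only [Function.comp_def, hξ.zero] using h
  have hψ : Continuous fun x => φ (-t) (ξ t z) x := by
    have h := (hφ.whitneyFlow hX hξ hF (ξ t z)).continuous_flow.comp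
      (f := fun x : X => (-t, (0 : ℝ), x)) (by fun_prop)
    simpa only [Function.comp_def, hξ.zero] using h
  obtain ⟨C, hC⟩ := (isCompact_univ (X := X)).exists_bound_of_continuousOn hJ.continuousOn
  have hint : ∀ i j, IntegrableOn (perronFrobenius I ξ φ z t ((B j).indicator fun _ => 1)) (B i)
      (normVolume d X) := by
    intro i j
    have hm : Measurable (perronFrobenius I ξ φ z t ((B j).indicator fun _ => (1 : ℝ))) :=
      ((measurable_const.indicator (hB j)).comp hψ.measurable).mul hJ.measurable
    refine Integrable.of_bound hm.aestronglyMeasurable (1 * C) (.of_forall fun x => ?_)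
    have hle : ‖(B j).indicator (fun _ => (1 : ℝ)) (φ (-t) (ξ t z) x)‖ ≤ 1 :=
      (norm_indicator_le_norm_self _ _).trans (by simp)
    have hCx : ‖absDet I (φ (-t) (ξ t z)) x‖ ≤ C := hC x (mem_univ x)
    rw [perronFrobenius, norm_mul]
    exact mul_le_mul hle hCx (norm_nonneg _) zero_le_one
  have hpf : perronFrobenius I ξ φ z t (stepFun B u) = fun x =>
      ∑ j, perronFrobenius I ξ φ z t ((B j).indicator fun _ => 1) x * u j := by
    ext x
    simp only [perronFrobenius, stepFun, Finset.sum_mul]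
    refine Finset.sum_congr rfl fun j _ => ?_
    by_cases hx : φ (-t) (ξ t z) x ∈ B j
    · simp [indicator_of_mem hx, mul_comm]
    · simp [indicator_of_notMem hx]
  rw [galerkin]
  congr 1
  ext i
  rw [hpf, integral_finsetSum _ fun j _ => (hint i j).mul_const (u j), Finset.sum_div]
  simp only [Matrix.mulVec, dotProduct, ulamMatrix, Matrix.of_apply]
  refine Finset.sum_congr rfl fun j _ => ?_
  rw [integral_mul_const]
  ring

end Flow

/-! ### Step functions and the choice of signs -/

section StepFun

variable {X : Type*} {n : ℕ} {B : Fin n → Set X}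

theorem stepFun_apply_of_mem (hB : Pairwise fun i j => Disjoint (B i) (B j)) {i : Fin n} {x : X}
    (hx : x ∈ B i) (u : Fin n → ℝ) : stepFun B u x = u i := by
  rw [stepFun, Finset.sum_eq_single i, indicator_of_mem hx]
  · intro j _ hj
    exact indicator_of_notMem (fun hxj => (hB hj).le_bot ⟨hxj, hx⟩) _
  · simp

theorem eLpNorm_stepFun [TopologicalSpace X] [MeasurableSpace X] {m : Measure X}
    [IsFiniteMeasure m] (hB : IsPositivePartition m B) (u : Fin n → ℝ) :
    eLpNorm (stepFun B u) 1 m = ENNReal.ofReal (∑ i, |u i| * m.real (B i)) := by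
  have h : ∀ x, ‖stepFun B u x‖ₑ = ∑ i, (B i).indicator (fun _ => ‖u i‖ₑ) x := by
    intro x
    obtain ⟨i, hi⟩ := mem_iUnion.1 (hB.iUnion ▸ mem_univ x)
    rw [stepFun_apply_of_mem hB.disjoint hi, Finset.sum_eq_single i, indicator_of_mem hi]
    · intro j _ hj
      exact indicator_of_notMem (fun hxj => (hB.disjoint hj).le_bot ⟨hxj, hi⟩) _
    · simp
  rw [eLpNorm_one_eq_lintegral_enorm, lintegral_congr h,
    lintegral_finsetSum _ fun i _ => measurable_const.indicator (hB.measurable i),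
    ENNReal.ofReal_sum_of_nonneg fun i _ => by positivity]
  refine Finset.sum_congr rfl fun i _ => ?_
  rw [lintegral_indicator_const (hB.measurable i), ENNReal.ofReal_mul (abs_nonneg _),
    ofReal_measureReal, ← Real.norm_eq_abs, ofReal_norm]

theorem eLpNorm_stepFun_eq_one [TopologicalSpace X] [MeasurableSpace X] {m : Measure X}
    [IsFiniteMeasure m] (hB : IsPositivePartition m B) {u : Fin n → ℝ} :
    eLpNorm (stepFun B u) 1 m = 1 ↔ ∑ i, |u i| * m.real (B i) = 1 := by
  rw [eLpNorm_stepFun hB, ENNReal.ofReal_eq_one]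

end StepFun

open scoped Matrix in
/-- Continuity, up to sign, of normalised vectors in a continuous family of lines. -/
theorem exists_sign_tendsto {n : ℕ} {μ : Fin n → ℝ} (hμ : ∀ i, 0 < μ i)
    {L : ℝ → Submodule ℝ (Fin n → ℝ)} (hL₀ : Module.finrank ℝ (L 0) = 1)
    (hL : ∀ (U : Ultrafilter ℝ), ↑U ≤ 𝓝 (0 : ℝ) → ∀ (u : ℝ → Fin n → ℝ) (w : Fin n → ℝ),
      (∀ᶠ δ in (U : Filter ℝ), u δ ∈ L δ) → Tendsto u U (𝓝 w) → w ∈ L 0)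
    {u : ℝ → Fin n → ℝ} (hu : ∀ᶠ δ in 𝓝 (0 : ℝ), u δ ∈ L δ ∧ ∑ i, |u δ i| * μ i = 1) :
    ∃ s : ℝ → ℝ, (∀ δ, s δ = 1 ∨ s δ = -1) ∧ Tendsto (fun δ => s δ • u δ) (𝓝 0) (𝓝 (u 0)) := by
  obtain ⟨hu0, hn0⟩ := hu.self_of_nhds
  have hne : u 0 ≠ 0 := fun h => by simp [h] at hn0
  -- With this sign every limit point is a normalised multiple `c • u 0` with `c ≥ 0`, so `c = 1`.
  let s : ℝ → ℝ := fun δ => if 0 ≤ u δ ⬝ᵥ u 0 then 1 else -1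
  have hs : ∀ δ, s δ = 1 ∨ s δ = -1 := fun δ => by
    by_cases h : 0 ≤ u δ ⬝ᵥ u 0
    · exact Or.inl (if_pos h)
    · exact Or.inr (if_neg h)
  have habs : ∀ δ, |s δ| = 1 := fun δ => by
    rcases hs δ with h | h <;> simp [h]
  have hpos : ∀ δ, 0 ≤ (s δ • u δ) ⬝ᵥ u 0 := fun δ => by
    by_cases h : 0 ≤ u δ ⬝ᵥ u 0
    · have : s δ = 1 := if_pos h
      simpa [this] using h
    · have : s δ = -1 := if_neg h
      simpa [this] using (not_le.1 h).le
  refine ⟨s, hs, tendsto_iff_ultrafilter _ _ _ |>.2 fun U hU => ?_⟩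
  have hnorm : ∀ᶠ δ in (U : Filter ℝ), ∑ i, |(s δ • u δ) i| * μ i = 1 := by
    filter_upwards [hU hu] with δ hδ
    simpa [abs_mul, habs] using hδ.2
  have hmem : ∀ᶠ δ in (U : Filter ℝ), s δ • u δ ∈ L δ := by
    filter_upwards [hU hu] with δ hδ
    exact (L δ).smul_mem _ hδ.1
  have hbd : ∀ᶠ δ in (U : Filter ℝ), s δ • u δ ∈
      Set.pi univ fun i => Icc (-(1 / μ i)) (1 / μ i) := by
    filter_upwards [hnorm] with δ hδ i _
    refine abs_le.1 ((le_div_iff₀ (hμ i)).2 ?_)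
    rw [← hδ]
    exact Finset.single_le_sum (f := fun i => |(s δ • u δ) i| * μ i)
      (fun j _ => mul_nonneg (abs_nonneg _) (hμ j).le) (Finset.mem_univ i)
  obtain ⟨w, -, hw⟩ := (isCompact_univ_pi fun i =>
    isCompact_Icc (a := -(1 / μ i)) (b := 1 / μ i)).ultrafilter_le_nhds
    (U.map fun δ => s δ • u δ) (le_principal_iff.2 (mem_map.2 hbd))
  have hw : Tendsto (fun δ => s δ • u δ) U (𝓝 w) := hw
  have hwL : w ∈ L 0 := hL U hU _ w hmem hw
  have hwn : ∑ i, |w i| * μ i = 1 := by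
    have hc : Continuous fun v : Fin n → ℝ => ∑ i, |v i| * μ i := by fun_prop
    exact tendsto_nhds_unique ((hc.tendsto w).comp hw)
      (tendsto_const_nhds.congr' (hnorm.mono fun δ hδ => hδ.symm))
  have hwp : 0 ≤ w ⬝ᵥ u 0 := by
    have hc : Continuous fun v : Fin n → ℝ => v ⬝ᵥ u 0 := by
      simp only [dotProduct]
      fun_prop
    exact ge_of_tendsto ((hc.tendsto w).comp hw) (.of_forall hpos)
  obtain ⟨c, hc⟩ := (finrank_eq_one_iff_of_nonzero' (⟨u 0, hu0⟩ : L 0)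
    (by simpa [Subtype.ext_iff] using hne)).1 hL₀ ⟨w, hwL⟩
  have hc : w = c • u 0 := (congrArg Subtype.val hc).symm
  have hc1 : |c| = 1 := by
    have : ∑ i, |w i| * μ i = |c| * ∑ i, |u 0 i| * μ i := by
      rw [Finset.mul_sum]
      refine Finset.sum_congr rfl fun i _ => ?_
      rw [hc, Pi.smul_apply, smul_eq_mul, abs_mul, mul_assoc]
    rw [hwn, hn0, mul_one] at this
    exact this.symm
  have hc0 : 0 ≤ c := by
    rw [hc, smul_dotProduct, smul_eq_mul] at hwp
    have : 0 < u 0 ⬝ᵥ u 0 := lt_of_le_of_ne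
      (Finset.sum_nonneg fun i _ => mul_self_nonneg _)
      fun h => hne (dotProduct_self_eq_zero.1 h.symm)
    exact nonneg_of_mul_nonneg_left hwp this
  rw [abs_of_nonneg hc0] at hc1
  rw [hc1, one_smul] at hc
  rwa [hc] at hw

/-! ### The main theorem -/

theorem mainTheorem2 {d D n : ℕ} {H : Type*} [TopologicalSpace H]
    (I : ModelWithCorners ℝ (EuclideanSpace ℝ (Fin d)) H)
    (X : Set (EuclideanSpace ℝ (Fin D))) [ChartedSpace H X] [IsManifold I ∞ X]
    (hXc : IsCompact X) (hX : IsSubmanifold I X)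
    {Ξ : Type*} (ξ : ℝ → Ξ → Ξ) (hξ : IsDrivingFlow ξ)
    (F : Ξ → X → EuclideanSpace ℝ (Fin D)) (hF : IsRegularField I ξ F)
    (φ : ℝ → Ξ → X → X) (hφ : IsFlowOf ξ F φ)
    (B : Fin n → Set X) (hB : IsPositivePartition (normVolume d X) B)
    (M N : ℝ) (hM : 0 < M) (hN : 0 ≤ N) (z : Ξ)
    (hU₂ : Module.finrank ℝ (singularSpace I ξ φ B M 2 (ξ (-N) z)) = 1)
    (hU₁ : ∀ᶠ δ in 𝓝 (0 : ℝ),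
      Module.finrank ℝ (singularSpace I ξ φ B M 1 (ξ (-N) (ξ δ z))) =
        Module.finrank ℝ (singularSpace I ξ φ B M 1 (ξ (-N) z))) :
    (∀ᶠ δ in 𝓝 (0 : ℝ),
      Module.finrank ℝ (singularSpace I ξ φ B M 2 (ξ (-N) (ξ δ z))) = 1) ∧
    ∀ f : ℝ → X → ℝ,
      (∀ᶠ δ in 𝓝 (0 : ℝ), IsApproxOseledets I ξ φ B M N (ξ δ z) (f δ)) →
      ∃ s : ℝ → ℝ, (∀ δ, s δ = 1 ∨ s δ = -1) ∧
        Tendsto (fun δ => eLpNorm (fun x => s δ * f δ x - f 0 x) 1 (normVolume d X))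
          (𝓝 0) (𝓝 0) := by
  have : CompactSpace X := isCompact_iff_compactSpace.1 hXc
  have hP : ∀ t, Continuous fun δ => ulamMatrix I ξ φ B (ξ (-N) (ξ δ z)) t := fun t => by
    have := (continuous_ulamMatrix hX hξ hF hφ hB.measurable z t).comp (continuous_const_add (-N))
    simpa only [Function.comp_def, hξ.add] using this
  have hS : ∀ j z', singularSpace I ξ φ B M j z' =
      orderedEigenspace ((ulamMatrix I ξ φ B z' M).transpose * ulamMatrix I ξ φ B z' M) j :=
    fun j z' => orderedEigenspace_cfc_rpow _ (by positivity) j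
  have hA : Continuous fun δ => (ulamMatrix I ξ φ B (ξ (-N) (ξ δ z)) M).transpose *
      ulamMatrix I ξ φ B (ξ (-N) (ξ δ z)) M := (hP M).matrix_transpose.matrix_mul (hP M)
  have hz : ξ (-N) z = ξ (-N) (ξ 0 z) := by rw [hξ.zero]
  rw [hz] at hU₂ hU₁
  have hpert := fun (U : Ultrafilter ℝ) (hU : ↑U ≤ 𝓝 (0 : ℝ)) =>
    orderedEigenspace_two_perturbation
      (fun δ => Matrix.isHermitian_conjTranspose_mul_self (ulamMatrix I ξ φ B (ξ (-N) (ξ δ z)) M))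
      U ((hA.tendsto 0).mono_left hU) (by rwa [hS] at hU₂)
      (hU (hU₁.mono fun δ hδ => by rwa [hS, hS] at hδ))
  refine ⟨mem_iff_ultrafilter.2 fun U hU => ?_, fun f hf => ?_⟩
  · have := (hpert U hU).1
    filter_upwards [this] with δ hδ
    rw [hS]
    exact hδ
  -- The coefficient vector is meaningful only where `f δ` is an Oseledets function; elsewhere it is
  -- set to zero.
  have hex : ∀ δ, ∃ u : Fin n → ℝ, IsApproxOseledets I ξ φ B M N (ξ δ z) (f δ) →
      (u ∈ singularSpace I ξ φ B M 2 (ξ (-N) (ξ δ z)) ∧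
        ∑ i, |u i| * (normVolume d X).real (B i) = 1) ∧
      f δ = stepFun B ((ulamMatrix I ξ φ B (ξ (-N) (ξ δ z)) N).mulVec u) := by
    intro δ
    by_cases h : IsApproxOseledets I ξ φ B M N (ξ δ z) (f δ)
    · obtain ⟨u, hu, hu1, hfu⟩ := h
      refine ⟨u, fun _ => ⟨⟨hu, (eLpNorm_stepFun_eq_one hB).1 hu1⟩, ?_⟩⟩
      rw [hfu, galerkin_perronFrobenius_stepFun hX hξ hF hφ hB.measurable]
    · exact ⟨0, fun h' => absurd h' h⟩
  choose u hu using hex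
  obtain ⟨s, hs, hsu⟩ := exists_sign_tendsto
    (μ := fun i => (normVolume d X).real (B i))
    (fun i => ENNReal.toReal_pos (hB.pos i).ne' (measure_ne_top _ _)) hU₂
    (fun U hU v w hv hw => by
      simp only [hS] at hv ⊢
      exact (hpert U hU).2 v w hv hw)
    (hf.mono fun δ hδ => (hu δ hδ).1)
  refine ⟨s, hs, ?_⟩
  -- Coefficients of the difference of the two step functions; its `L¹` norm is a continuous
  -- function of them.
  let g : ℝ → Fin n → ℝ := fun δ => (ulamMatrix I ξ φ B (ξ (-N) (ξ δ z)) N).mulVec (s δ • u δ) -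
    (ulamMatrix I ξ φ B (ξ (-N) (ξ 0 z)) N).mulVec (u 0)
  have hg : Tendsto g (𝓝 0) (𝓝 0) := by
    have h1 : Tendsto (fun δ => (ulamMatrix I ξ φ B (ξ (-N) (ξ δ z)) N).mulVec (s δ • u δ)) (𝓝 0)
        (𝓝 ((ulamMatrix I ξ φ B (ξ (-N) (ξ 0 z)) N).mulVec (u 0))) :=
      ((Continuous.matrix_mulVec (A := fun p : Matrix (Fin n) (Fin n) ℝ × (Fin n → ℝ) => p.1)
        continuous_fst continuous_snd).tendsto _).comp (((hP N).tendsto 0).prodMk_nhds hsu)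
    simpa [g] using h1.sub_const ((ulamMatrix I ξ φ B (ξ (-N) (ξ 0 z)) N).mulVec (u 0))
  have hlim : Tendsto (fun δ => ENNReal.ofReal (∑ i, |g δ i| * (normVolume d X).real (B i)))
      (𝓝 0) (𝓝 0) := by
    have hc : Continuous fun v : Fin n → ℝ =>
        ENNReal.ofReal (∑ i, |v i| * (normVolume d X).real (B i)) :=
      ENNReal.continuous_ofReal.comp (by fun_prop)
    simpa [Function.comp_def] using (hc.tendsto 0).comp hg
  refine hlim.congr' ?_
  filter_upwards [hf] with δ hδ
  rw [← eLpNorm_stepFun hB]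
  congr 1
  ext x
  obtain ⟨i, hi⟩ := mem_iUnion.1 (hB.iUnion ▸ mem_univ x)
  rw [(hu δ hδ).2, (hu 0 hf.self_of_nhds).2]
  simp only [stepFun_apply_of_mem hB.disjoint hi]
  simp [g, Matrix.mulVec_smul]
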